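/- Let $\nu$ be a Borel probability measure on $\mathbb R^d$ with $\int |x|^3\,d\nu<\infty$, absolutely continuous with respect to the standard Gaussian measure, of the form $\nu(dx)=p(x)\,dx$, $p=e^{-U}\mathbf 1_\Omega$, where $\Omega=\operatorname{supp}\nu$ is convex and $U$ is $C^2$ on the interior of $\Omega$. Assume that $\nu$ is $\beta$-semi-log-convex for some $\beta>0$, i.e. $\nabla^2U\preceq\beta I_d$ on the interior of $\Omega$. Let $s>0$ and let $V$ be the Föllmer velocity field with $\mu=0$, $\Sigma=s^2I_d$: $$V(t,x)=\frac{x+s^2\nabla\ln q_t(x)}{t}\quad(0<t\le1),\qquad V(0,x)=\int y\,\nu(dy),$$ where $q_t(x)=\int \varphi^{ty,(1-t^2)s^2I_d}(x)\,p(y)\,dy$ for $t<1$, $q_1=p$, and $\varphi^{m,vI_d}$ is the density of $N(m,vI_d)$. Put $D=\frac1{\sqrt2}\operatorname{diam}(\Omega)\in[0,\infty]$ and $$A_t=\frac{tD^2}{s^2(1-t^2)^2}-\frac{t}{1-t^2},\qquad B_t=\frac{t(1-\kappa s^2)}{(1-\kappa s^2)t^2+\kappa s^2}.$$ At all points named in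 (1)–(4) the Jacobian $\nabla V(t,x)$ (in $x$) exists and is symmetric. In (2) and (3), for $t=1$ the point $x$ is restricted to the interior of $\Omega$. Suppose that $\nu$ is $\kappa$-semi-log-concave ($\nabla^2U\succeq\kappa I_d$ on the interior of $\Omega$) and that either $\kappa>0$ and $D\in(0,\infty]$, or $\kappa\le0$ and $D\in(0,\infty)$. Then: 1. If $D<\infty$, then $\nabla V(t,x)\preceq A_t I_d$ for all $t\in[0,1)$ and $x\in\mathbb R^d$. 2. $\nabla V(t,x)\preceq B_t I_d$ for all $t\in\Big[\sqrt{\tfrac{\kappa s^2}{\kappa s^2-1}\mathbf 1_{\kappa<0}},\,1\Big]$ for which the denominator of $B_t$ is nonzero, and all $x\in\mathbb R^d$. 3. (Summary.) $\lambda_{\max}(\nabla V(t,x))\le\theta_t$ for all $t\in[0,1]$ and $x\in\mathbb R^d$, with $\theta_t$ as follows. If $\kappa D^2\ge1$ (including $D=\infty$), then $\theta_t=B_t$; and $B_t\le A_t$ for all $t\in[0,1)$ when $D<\infty$. If $\kappa D^2<1$, then $\theta_t=A_t$ for $t\in[0,t_0)$ and $\theta_t=B_t$ for $t\in[t_0,1]$,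 where $$t_0=\sqrt{\frac{s^2(1-\kappa D^2)}{s^2(1-\kappa D^2)+D^2}}\in(0,1)\quad\text{solves}\quad s^2(D^{-2}-\kappa)=\frac{t^2}{1-t^2};$$ moreover $A_t\le B_t$ for those $t\in[0,t_0)$ at which the denominator of $B_t$ is positive, while for $t\in[t_0,1)$ that denominator is positive and $B_t\le A_t$. If instead (or in addition) $\nu=N(0,\sigma^2I_d)*\rho$ with $\sigma>0$ and $\rho$ a probability measure supported in a ball of radius $R$ (with any centre), then: 4. for all $t\in[0,1]$ and $x\in\mathbb R^d$, $$\nabla V(t,x)\preceq t\cdot\frac{(\sigma^2-s^2)\,[s^2+(\sigma^2-s^2)t^2]+R^2s^2}{[s^2+(\sigma^2-s^2)t^2]^2}\,I_d,$$ and hence the same bound for $\lambda_{\max}(\nabla V(t,x))$. -/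

import Mathlib

open MeasureTheory ProbabilityTheory
open scoped ENNReal

noncomputable section

namespace Follmer

/-- Euclidean space `ℝᵈ`. -/
abbrev E (d : ℕ) : Type := EuclideanSpace ℝ (Fin d)

variable {d : ℕ}

/-! ### Targets of the form `ν(dx) = exp(-U(x)) dx` -/

/-- The Lebesgue density `p` of `ν(dx) = exp(-U(x)) dx`: it is `exp(-U)` on the support of `ν`,
and zero outside. -/
def density (ν : Measure (E d)) (U : E d → ℝ) : E d → ℝ :=
  ν.support.indicator fun x => Real.exp (-U x)

/-- `ν(dx) = exp(-U(x)) dx` with convex support `Ω` and `U` of class `C²` on `Ω`. The support is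
the topological (closed) one; the regularity of `U` is only asked in its interior (the boundary of
a convex set is Lebesgue-null). -/
structure HasPotential (ν : Measure (E d)) (U : E d → ℝ) : Prop where
  convex_support : Convex ℝ ν.support
  contDiffOn : ContDiffOn ℝ 2 U (interior ν.support)
  eq_withDensity : ν = volume.withDensity fun x => ENNReal.ofReal (density ν U x)

/-- `ν(dx) = exp(-U(x)) dx` is `κ`-semi-log-concave: `∇²U ⪰ κ I`. -/
def IsSemiLogConcave (ν : Measure (E d)) (U : E d → ℝ) (κ : ℝ) : Prop :=
  HasPotential ν U ∧
    ∀ x ∈ interior ν.support, ∀ v : E d, κ * ‖v‖ ^ 2 ≤ fderiv ℝ (fderiv ℝ U) x v v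

/-- `ν(dx) = exp(-U(x)) dx` is `β`-semi-log-convex: `∇²U ⪯ β I`. -/
def IsSemiLogConvex (ν : Measure (E d)) (U : E d → ℝ) (β : ℝ) : Prop :=
  HasPotential ν U ∧
    ∀ x ∈ interior ν.support, ∀ v : E d, fderiv ℝ (fderiv ℝ U) x v v ≤ β * ‖v‖ ^ 2

/-- `ν` has a finite third moment and is absolutely continuous with respect to the standard
Gaussian measure. -/
structure MomentAC (ν : Measure (E d)) : Prop where
  third_moment : Integrable (fun x : E d => ‖x‖ ^ 3) ν
  absolutelyContinuous : ν ≪ stdGaussian (E d)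

/-- `D = (1/√2) diam(supp ν)`, a number in `[0, ∞]`. -/
def scaledDiam (ν : Measure (E d)) : ℝ≥0∞ :=
  ENNReal.ofReal (1 / √2) * Metric.ediam ν.support

/-- Either `ν` is `κ`-semi-log-concave with `κ > 0` and `D ∈ (0, ∞]`, or `ν` is
`κ`-semi-log-concave with `κ ≤ 0` and `D ∈ (0, ∞)`. -/
def LogConcaveCase (ν : Measure (E d)) (U : E d → ℝ) (κ : ℝ) : Prop :=
  (0 < κ ∧ IsSemiLogConcave ν U κ ∧ 0 < scaledDiam ν) ∨
    (κ ≤ 0 ∧ IsSemiLogConcave ν U κ ∧ 0 < scaledDiam ν ∧ scaledDiam ν < ⊤)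

/-- `ν = N(0, σ² I) ∗ ρ` for a probability measure `ρ` supported on a ball of radius `R`. -/
def GaussianConvCase (ν : Measure (E d)) (σ R : ℝ) : Prop :=
  ∃ (ρ : Measure (E d)) (c : E d), IsProbabilityMeasure ρ ∧ ρ (Metric.closedBall c R)ᶜ = 0 ∧
    ν = (multivariateGaussian 0 ((σ ^ 2) • (1 : Matrix (Fin d) (Fin d) ℝ))).conv ρ

/-! ### The Föllmer velocity field for the reference measure `N(0, s² I)` -/

/-- The density at `x` of the Gaussian measure `N(m, v I)` on `ℝᵈ`, for `v > 0`. -/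
def gaussianDensity (m : E d) (v : ℝ) (x : E d) : ℝ :=
  (√(2 * Real.pi * v))⁻¹ ^ d * Real.exp (-‖x - m‖ ^ 2 / (2 * v))

/-- `q_t(x) = ∫ q(t, x | 1, y) p(y) dy` where `q(t, · | 1, y)` is the density of
`N(t y, (1 - t²) s² I)`. At `t = 1` this Gaussian is the Dirac mass at `y`, so `q_1 = p`. -/
def marginalDensity (s : ℝ) (p : E d → ℝ) (t : ℝ) (x : E d) : ℝ :=
  if t = 1 then p x else ∫ y, gaussianDensity (t • y) ((1 - t ^ 2) * s ^ 2) x * p y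

/-- The score function `S(t, x) = ∇ ln q_t(x)`. -/
def score (s : ℝ) (p : E d → ℝ) (t : ℝ) (x : E d) : E d :=
  gradient (fun z => Real.log (marginalDensity s p t z)) x

/-- The Föllmer velocity field of `ν(dx) = exp(-U(x)) dx` with `μ = 0` and `Σ = s² I`:
`V(t, x) = (x + s² S(t, x)) / t` for `t ∈ (0, 1]`, and `V(0, x) = E_ν[X]`. -/
def velocity (s : ℝ) (ν : Measure (E d)) (U : E d → ℝ) (t : ℝ) (x : E d) : E d :=
  if t = 0 then ∫ y, y ∂ν else t⁻¹ • (x + s ^ 2 • score s (density ν U) t x)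

/-! ### Upper bounds on Jacobians -/

/-- The Jacobian of `F` at `x` exists and `∇F(x) ⪯ c I` in the Loewner order; in particular
`∇F(x)` is symmetric. -/
def JacobianLE (F : E d → E d) (x : E d) (c : ℝ) : Prop :=
  DifferentiableAt ℝ F x ∧ fderiv ℝ F x ≤ c • ContinuousLinearMap.id ℝ (E d)

/-- The Jacobian of `F` at `x` exists, is symmetric, and its largest eigenvalue is at most `c`. -/
def LambdaMaxJacobianLE (F : E d → E d) (x : E d) (c : ℝ) : Prop :=
  DifferentiableAt ℝ F x ∧ (fderiv ℝ F x : E d →ₗ[ℝ] E d).IsSymmetric ∧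
    ∀ l : ℝ, Module.End.HasEigenvalue (fderiv ℝ F x : E d →ₗ[ℝ] E d) l → l ≤ c

/-- `t D² / (s² (1 - t²)²) - t / (1 - t²)`. -/
def diamBound (s D t : ℝ) : ℝ :=
  t * D ^ 2 / (s ^ 2 * (1 - t ^ 2) ^ 2) - t / (1 - t ^ 2)

/-- The denominator `(1 - κ s²) t² + κ s²` of the `κ`-based bound. -/
def kappaDenom (s κ t : ℝ) : ℝ :=
  (1 - κ * s ^ 2) * t ^ 2 + κ * s ^ 2

/-- `t (1 - κ s²) / ((1 - κ s²) t² + κ s²)`. -/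
def kappaBound (s κ t : ℝ) : ℝ :=
  t * (1 - κ * s ^ 2) / kappaDenom s κ t

/-- The initial time `√(κ s² / (κ s² - 1) · 1_{κ < 0})` of the `κ`-based bound. -/
def kappaStart (s κ : ℝ) : ℝ :=
  √(if κ < 0 then κ * s ^ 2 / (κ * s ^ 2 - 1) else 0)

/-- The crossover time `t₀ = √(s² (1 - κ D²) / (s² (1 - κ D²) + D²))`. -/
def crossover (s κ D : ℝ) : ℝ :=
  √(s ^ 2 * (1 - κ * D ^ 2) / (s ^ 2 * (1 - κ * D ^ 2) + D ^ 2))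

/-- `θ_t` when `κ D² < 1`: the `D²`-based bound on `[0, t₀)`, the `κ`-based bound on `[t₀, 1]`. -/
def crossoverBound (s κ D t : ℝ) : ℝ :=
  if t < crossover s κ D then diamBound s D t else kappaBound s κ t

/-- `t ((σ² - s²) [s² + (σ² - s²) t²] + R² s²) / [s² + (σ² - s²) t²]²`. -/
def convBound (s σ R t : ℝ) : ℝ :=
  t * (((σ ^ 2 - s ^ 2) * (s ^ 2 + (σ ^ 2 - s ^ 2) * t ^ 2) + R ^ 2 * s ^ 2)
    / (s ^ 2 + (σ ^ 2 - s ^ 2) * t ^ 2) ^ 2)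

end Follmer

end

open Follmer

noncomputable section

namespace Follmer

variable {d : ℕ}

set_option maxSynthPendingDepth 3
set_option linter.unusedSectionVars false

/-! For `0 < t < 1` the density `q_t` is a positive constant times the Gaussian mixture `Q(x) = ∫
g_v(x - t y) ν(dy)` with `v = (1 - t²) s²`. Hence `∇V = t⁻¹ (I + s² ∇² ln Q)`, and every bound on
`∇V` is an upper bound on the Hessian of the logarithm of a Gaussian mixture
(`jacobianLE_velocity_of_mixture`). At `t = 0` the field is constant.

In direction `w` that Hessian equals `Var⟨x - t y, w⟩ / v² - ‖w‖² / v`, the variance being taken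
under the mixing measure tilted by the kernel. A variance is at most the second moment about any
point, so an almost sure bound on the oscillation of `⟨y, w⟩` controls it
(`logGaussMixtureFDeriv₂_le`). With mixing measure `ν` this gives the diameter bound. If `ν = N(0,
σ² I) ∗ ρ`, the Gaussian factor is absorbed into the kernel, whose variance becomes `v + t² σ²`; the
mixing measure is then `ρ`, and its radius gives the convolution bound. The same representation
persists at `t = 1` (`exists_density_conv`).

For the `κ`-based bound, put `α = κ / (t² + κ v)` with a positive denominator. The exponent of
`exp(α ‖x‖² / 2) g_v(x - t y) exp(-U(y))` is midpoint concave jointly in `(x, y)`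
(`gaussian_exponent_midpoint_le`). Integrating out `y` by Prékopa–Leindler
(`prekopaLeindler_euclidean`) keeps midpoint log-concavity in `x`, so `∇² ln Q ⪯ -α I`. At `t = 1`
the bound is read off from `-∇²U`.

Once a common factor is extracted, the two bounds are ordered by the sign of a single expression,
affine in `t²` (`sq_mul_kappaDenom_sub`), whose zero is the crossover time when `κ D² < 1`. -/

/-! ### Jacobians of gradient fields -/

/-- A criterion for `JacobianLE` in terms of the quadratic form of the derivative. -/
lemma jacobianLE_of_forall {F : E d → E d} {x : E d} {c : ℝ} {T : E d →L[ℝ] E d}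
    (hF : HasFDerivAt F T x) (hsymm : ∀ v w, inner ℝ (T v) w = inner ℝ v (T w))
    (hle : ∀ w, inner ℝ (T w) w ≤ c * ‖w‖ ^ 2) : JacobianLE F x c := by
  refine ⟨hF.differentiableAt, ?_⟩
  rw [hF.fderiv, ContinuousLinearMap.le_def]
  constructor
  · intro v w
    simp [inner_sub_left, inner_sub_right, inner_smul_left, inner_smul_right, hsymm]
  · intro w
    have := hle w
    simp only [ContinuousLinearMap.reApplyInnerSelf, sub_apply, smul_apply, ContinuousLinearMap.id_apply,
      inner_sub_left, inner_smul_left, RCLike.re_to_real, real_inner_self_eq_norm_sq,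
      conj_trivial]
    linarith

lemma JacobianLE.lambdaMax {F : E d → E d} {x : E d} {c : ℝ} (h : JacobianLE F x c) :
    LambdaMaxJacobianLE F x c := by
  obtain ⟨hF, hle⟩ := h
  rw [ContinuousLinearMap.le_def] at hle
  refine ⟨hF, ?_, ?_⟩
  · intro v w
    have := hle.1 v w
    simp [inner_sub_left, inner_sub_right, inner_smul_left, inner_smul_right] at this
    simpa using this
  · intro l hl
    obtain ⟨w, hw⟩ := hl.exists_hasEigenvector
    have h1 := hle.2 w
    have h2 := hw.apply_eq_smul
    simp only [ContinuousLinearMap.coe_coe] at h2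
    simp only [ContinuousLinearMap.reApplyInnerSelf, sub_apply, smul_apply, ContinuousLinearMap.id_apply,
      inner_sub_left, inner_smul_left, RCLike.re_to_real, real_inner_self_eq_norm_sq,
      conj_trivial, h2] at h1
    have h3 : 0 < ‖w‖ ^ 2 := by have := norm_pos_iff.2 hw.2; positivity
    nlinarith

lemma jacobianLE_const (y x : E d) : JacobianLE (fun _ : E d => y) x 0 :=
  jacobianLE_of_forall (hasFDerivAt_const y x) (by simp) (by simp)

lemma JacobianLE.congr_of_eventuallyEq {F G : E d → E d} {x : E d} {c : ℝ}
    (h : JacobianLE F x c) (hFG : G =ᶠ[nhds x] F) : JacobianLE G x c :=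
  ⟨hFG.differentiableAt_iff.2 h.1, by rw [hFG.fderiv_eq]; exact h.2⟩

/-- The Jacobian of `y ↦ t⁻¹ (y + a ∇L(y))` is bounded in terms of the Hessian of `L`. -/
lemma jacobianLE_gradient_field {L : E d → ℝ} {x : E d} {L' : E d → E d →L[ℝ] ℝ}
    {L'' : E d →L[ℝ] E d →L[ℝ] ℝ} {t a c : ℝ} (ht : 0 < t) (ha : 0 ≤ a)
    (h1 : ∀ᶠ y in nhds x, HasFDerivAt L (L' y) y) (h2 : HasFDerivAt L' L'' x)
    (hle : ∀ w, L'' w w ≤ c * ‖w‖ ^ 2) :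
    JacobianLE (fun y => t⁻¹ • (y + a • gradient L y)) x (t⁻¹ * (1 + a * c)) := by
  have hsymm : ∀ v w, L'' v w = L'' w v := fun v w =>
    second_derivative_symmetric_of_eventually h1 h2 v w
  -- The inverse Riesz map is typed as conjugate-linear; over `ℝ` it is repackaged as a linear map
  -- so that it can be composed with derivatives.
  let J : (E d →L[ℝ] ℝ) →L[ℝ] E d := LinearMap.toContinuousLinearMap
    { toFun := (InnerProductSpace.toDual ℝ (E d)).symm
      map_add' := map_add _
      map_smul' := fun c l => by simp }
  have hJ : ∀ l w, inner ℝ (J l) w = l w := fun l w =>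
    InnerProductSpace.toDual_symm_apply (𝕜 := ℝ) (E := E d)
  have hg : HasFDerivAt (fun y => t⁻¹ • (y + a • J (L' y)))
      (t⁻¹ • (ContinuousLinearMap.id ℝ (E d) + a • (J.comp L''))) x :=
    ((hasFDerivAt_id x).add ((J.hasFDerivAt.comp x h2).const_smul a)).const_smul t⁻¹
  have hJ' : ∀ l w, inner ℝ w (J l) = l w := fun l w => by rw [real_inner_comm, hJ]
  refine (jacobianLE_of_forall hg ?_ ?_).congr_of_eventuallyEq ?_
  · intro v w
    simp only [smul_apply, add_apply,
      ContinuousLinearMap.id_apply, ContinuousLinearMap.comp_apply, inner_smul_left,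
      inner_smul_right, inner_add_left, inner_add_right, hJ, hJ', conj_trivial, hsymm v w]
  · intro w
    simp only [smul_apply, add_apply,
      ContinuousLinearMap.id_apply, ContinuousLinearMap.comp_apply, inner_smul_left,
      inner_add_left, hJ, conj_trivial, real_inner_self_eq_norm_sq]
    have := mul_le_mul_of_nonneg_left (hle w) ha
    have ht' : 0 ≤ t⁻¹ := by positivity
    have := mul_le_mul_of_nonneg_left this ht'
    linarith
  · filter_upwards [h1] with y hy
    simp only [gradient, hy.fderiv]
    rfl

/-! ### Gaussian mixtures -/

section Gaussian

variable {V : Type*} [NormedAddCommGroup V] [InnerProductSpace ℝ V]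

/-- The real inner product as a continuous bilinear form. -/
def innerBilin : V →L[ℝ] V →L[ℝ] ℝ :=
  (innerₗ (V)).mkContinuous₂ 1 fun u w => by
    simpa using norm_inner_le_norm (𝕜 := ℝ) u w

@[simp] lemma innerBilin_apply (u w : V) : innerBilin u w = inner ℝ u w := rfl

lemma norm_innerBilin_le : ‖(innerBilin : V →L[ℝ] V →L[ℝ] ℝ)‖ ≤ 1 :=
  LinearMap.mkContinuous₂_norm_le _ zero_le_one _

lemma norm_innerBilin_apply_le (u : V) : ‖innerBilin u‖ ≤ ‖u‖ := by
  simpa using innerBilin.le_of_opNorm_le norm_innerBilin_le u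

/-- The unnormalised centred Gaussian density of variance `v`. -/
def gaussKernel (v : ℝ) (u : V) : ℝ := Real.exp (-‖u‖ ^ 2 / (2 * v))

/-- The derivative of the Gaussian kernel. -/
def gaussKernelFDeriv (v : ℝ) (u : V) : V →L[ℝ] ℝ := -(gaussKernel v u / v) • innerBilin u

/-- The second derivative of the Gaussian kernel. -/
def gaussKernelFDeriv₂ (v : ℝ) (u : V) : V →L[ℝ] V →L[ℝ] ℝ :=
  (gaussKernel v u / v ^ 2) • (innerBilin u).smulRight (innerBilin u) +
    (-(gaussKernel v u / v)) • innerBilin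

lemma gaussKernelFDeriv_apply (v : ℝ) (u w : V) :
    gaussKernelFDeriv v u w = -(gaussKernel v u * inner ℝ u w) / v := by
  simp [gaussKernelFDeriv]
  ring

lemma gaussKernelFDeriv₂_apply (v : ℝ) (u w : V) :
    gaussKernelFDeriv₂ v u w w =
      gaussKernel v u * inner ℝ u w ^ 2 / v ^ 2 - ‖w‖ ^ 2 / v * gaussKernel v u := by
  simp [gaussKernelFDeriv₂]
  ring

lemma gaussKernel_pos (v : ℝ) (u : V) : 0 < gaussKernel v u := Real.exp_pos _

@[fun_prop] lemma continuous_gaussKernel (v : ℝ) : Continuous (gaussKernel v : V → ℝ) := by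
  unfold gaussKernel; fun_prop

@[fun_prop] lemma continuous_gaussKernelFDeriv (v : ℝ) :
    Continuous (gaussKernelFDeriv v : V → _) := by
  unfold gaussKernelFDeriv; fun_prop

@[fun_prop] lemma continuous_gaussKernelFDeriv₂ (v : ℝ) :
    Continuous (gaussKernelFDeriv₂ v : V → _) := by
  unfold gaussKernelFDeriv₂
  have : Continuous fun u : V => (innerBilin u).smulRight (innerBilin u) :=
    ((ContinuousLinearMap.smulRightL ℝ (V) (V →L[ℝ] ℝ)).continuous.comp
      (innerBilin).continuous).clm_apply (innerBilin).continuous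
  have hc := continuous_gaussKernel (V := V) v
  exact ((hc.div_const _).smul this).add ((hc.div_const _).neg.smul continuous_const)

lemma gaussKernel_le_one {v : ℝ} (hv : 0 < v) (u : V) : gaussKernel v u ≤ 1 := by
  unfold gaussKernel
  rw [Real.exp_le_one_iff, neg_div]
  have : 0 ≤ ‖u‖ ^ 2 / (2 * v) := by positivity
  linarith

/-- This is `a ≤ exp a` at `a = ‖u‖² / (2v)`. Together with the bound by one it gives the uniform
bounds on both kernel derivatives that justify differentiating under the integral. -/
lemma gaussKernel_mul_sq_le {v : ℝ} (hv : 0 < v) (u : V) :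
    gaussKernel v u * ‖u‖ ^ 2 ≤ 2 * v := by
  unfold gaussKernel
  have h := Real.add_one_le_exp (‖u‖ ^ 2 / (2 * v))
  have h2 : ‖u‖ ^ 2 ≤ Real.exp (‖u‖ ^ 2 / (2 * v)) * (2 * v) := by
    rw [← div_le_iff₀ (by positivity)]; linarith
  rw [neg_div, Real.exp_neg, inv_mul_le_iff₀ (Real.exp_pos _)]
  exact h2

lemma hasFDerivAt_gaussKernel (v : ℝ) (u : V) :
    HasFDerivAt (gaussKernel v) (gaussKernelFDeriv v u) u := by
  have h := (((hasStrictFDerivAt_norm_sq u).hasFDerivAt.neg.mul_const ((2 * v)⁻¹))).exp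
  have h' : (gaussKernel v : V → ℝ) = fun u => Real.exp ((-fun u => ‖u‖ ^ 2) u * (2 * v)⁻¹) := by
    ext u; simp [gaussKernel, div_eq_mul_inv]
  rw [h']
  refine h.congr_fderiv ?_
  ext w
  simp [gaussKernelFDeriv, gaussKernel]
  ring_nf

lemma hasFDerivAt_gaussKernelFDeriv (v : ℝ) (u : V) :
    HasFDerivAt (gaussKernelFDeriv v) (gaussKernelFDeriv₂ v u) u := by
  have h := ((hasFDerivAt_gaussKernel v u).mul_const v⁻¹).neg.smul
    ((innerBilin : V →L[ℝ] V →L[ℝ] ℝ).hasFDerivAt (x := u))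
  refine h.congr_fderiv ?_
  ext w z
  simp [gaussKernelFDeriv₂, gaussKernelFDeriv]
  ring_nf

lemma norm_gaussKernelFDeriv_le {v : ℝ} (hv : 0 < v) (u : V) :
    ‖gaussKernelFDeriv v u‖ ≤ (1 + 2 * v) / v := by
  unfold gaussKernelFDeriv
  have h0 := gaussKernel_pos v u
  rw [norm_smul, norm_neg, Real.norm_of_nonneg (by positivity)]
  refine (mul_le_mul_of_nonneg_left (norm_innerBilin_apply_le u) (by positivity)).trans ?_
  rw [div_mul_eq_mul_div]
  have h1 := gaussKernel_mul_sq_le hv u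
  have h2 := gaussKernel_le_one hv u
  gcongr
  nlinarith [sq_nonneg (‖u‖ - 1)]

lemma norm_gaussKernelFDeriv₂_le {v : ℝ} (hv : 0 < v) (u : V) :
    ‖gaussKernelFDeriv₂ v u‖ ≤ 2 * v / v ^ 2 + 1 / v := by
  unfold gaussKernelFDeriv₂
  have h0 := gaussKernel_pos v u
  refine (norm_add_le ((gaussKernel v u / v ^ 2) • (innerBilin u).smulRight (innerBilin u))
    ((-(gaussKernel v u / v)) • innerBilin)).trans (add_le_add ?_ ?_)
  · rw [norm_smul, ContinuousLinearMap.norm_smulRight_apply, Real.norm_of_nonneg (by positivity),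
      ← sq]
    refine (mul_le_mul_of_nonneg_left (pow_le_pow_left₀ (norm_nonneg _)
      (norm_innerBilin_apply_le u) 2) (by positivity)).trans ?_
    rw [div_mul_eq_mul_div]
    have h1 := gaussKernel_mul_sq_le hv u
    gcongr
  · rw [norm_smul, norm_neg, Real.norm_of_nonneg (by positivity)]
    have h2 := gaussKernel_le_one hv u
    have h3 : ‖(innerBilin : V →L[ℝ] V →L[ℝ] ℝ)‖ ≤ 1 := norm_innerBilin_le
    calc _ ≤ 1 / v * 1 := by gcongr
      _ = _ := mul_one _

variable [MeasurableSpace V] [BorelSpace V] [SecondCountableTopology V]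

/-- Differentiation under the integral sign for a mixture of translates. -/
lemma hasFDerivAt_integral_translates {F : Type*} [NormedAddCommGroup F] [NormedSpace ℝ F]
    {G : V → F} {G' : V → V →L[ℝ] F} {C C' : ℝ} (hG : ∀ u, HasFDerivAt G (G' u) u)
    (hG' : Continuous G') (hC : ∀ u, ‖G u‖ ≤ C) (hC' : ∀ u, ‖G' u‖ ≤ C')
    (ρ : Measure (V)) [IsFiniteMeasure ρ] (t : ℝ) (x : V) :
    HasFDerivAt (fun x => ∫ y, G (x - t • y) ∂ρ) (∫ y, G' (x - t • y) ∂ρ) x := by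
  have hGc : Continuous G := continuous_iff_continuousAt.2 fun u => (hG u).continuousAt
  have hmeas : ∀ x, AEStronglyMeasurable (fun y => G (x - t • y)) ρ := fun x =>
    (hGc.comp (by fun_prop)).aestronglyMeasurable
  refine hasFDerivAt_integral_of_dominated_of_fderiv_le (s := Set.univ)
    (F' := fun x y => G' (x - t • y)) (bound := fun _ => C') Filter.univ_mem
    (.of_forall hmeas) ?_ (hG'.comp (by fun_prop)).aestronglyMeasurable
    (.of_forall fun _ _ _ => hC' _) (integrable_const _) (.of_forall fun y z _ => ?_)
  · exact Integrable.of_bound (hmeas x) C (.of_forall fun _ => hC _)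
  · exact (hG (z - t • y)).comp z ((hasFDerivAt_id z).sub_const (t • y))

/-- The mixture `x ↦ ∫ g_v(x - t y) ρ(dy)` of Gaussian kernels. -/
def gaussMixture (v t : ℝ) (ρ : Measure (V)) (x : V) : ℝ := ∫ y, gaussKernel v (x - t • y) ∂ρ

section Mixture

variable {v t : ℝ} {ρ : Measure (V)}

lemma hasFDerivAt_gaussMixture [IsFiniteMeasure ρ] (hv : 0 < v) (x : V) :
    HasFDerivAt (gaussMixture v t ρ) (∫ y, gaussKernelFDeriv v (x - t • y) ∂ρ) x :=
  hasFDerivAt_integral_translates (C := 1) (hasFDerivAt_gaussKernel v) (by fun_prop)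
    (fun u => by rw [Real.norm_of_nonneg (gaussKernel_pos v u).le]; exact gaussKernel_le_one hv u)
    (norm_gaussKernelFDeriv_le hv) ρ t x

lemma hasFDerivAt_fderiv_gaussMixture [IsFiniteMeasure ρ] (hv : 0 < v) (x : V) :
    HasFDerivAt (fun x => ∫ y, gaussKernelFDeriv v (x - t • y) ∂ρ)
      (∫ y, gaussKernelFDeriv₂ v (x - t • y) ∂ρ) x :=
  hasFDerivAt_integral_translates (hasFDerivAt_gaussKernelFDeriv v) (by fun_prop)
    (norm_gaussKernelFDeriv_le hv) (norm_gaussKernelFDeriv₂_le hv) ρ t x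

lemma integrable_gaussKernel [IsFiniteMeasure ρ] (hv : 0 < v) (x : V) :
    Integrable (fun y => gaussKernel v (x - t • y)) ρ :=
  Integrable.of_bound (Continuous.aestronglyMeasurable (by fun_prop)) 1 (.of_forall fun y => by
    rw [Real.norm_of_nonneg (gaussKernel_pos v _).le]; exact gaussKernel_le_one hv _)

lemma gaussMixture_pos [IsProbabilityMeasure ρ] (hv : 0 < v) (x : V) :
    0 < gaussMixture v t ρ x :=
  (integral_pos_iff_support_of_nonneg (fun _ => (gaussKernel_pos v _).le)
    (integrable_gaussKernel hv x)).2 <| by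
      have : Function.support (fun y => gaussKernel v (x - t • y)) = Set.univ :=
        Set.eq_univ_of_forall fun y => (gaussKernel_pos v _).ne'
      simp [this]
/-- The derivative of a Gaussian mixture. -/
def gaussMixtureFDeriv (v t : ℝ) (ρ : Measure V) (x : V) : V →L[ℝ] ℝ :=
  ∫ y, gaussKernelFDeriv v (x - t • y) ∂ρ

/-- The second derivative of a Gaussian mixture. -/
def gaussMixtureFDeriv₂ (v t : ℝ) (ρ : Measure V) (x : V) : V →L[ℝ] V →L[ℝ] ℝ :=
  ∫ y, gaussKernelFDeriv₂ v (x - t • y) ∂ρ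

/-- The second derivative of the logarithm of a Gaussian mixture. -/
def logGaussMixtureFDeriv₂ (v t : ℝ) (ρ : Measure V) (x : V) : V →L[ℝ] V →L[ℝ] ℝ :=
  (gaussMixture v t ρ x)⁻¹ • gaussMixtureFDeriv₂ v t ρ x +
    (-((gaussMixture v t ρ x) ^ 2)⁻¹ • gaussMixtureFDeriv v t ρ x).smulRight
      (gaussMixtureFDeriv v t ρ x)

lemma hasFDerivAt_log_gaussMixture [IsProbabilityMeasure ρ] (hv : 0 < v) (x : V) :
    HasFDerivAt (fun x => Real.log (gaussMixture v t ρ x))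
      ((gaussMixture v t ρ x)⁻¹ • gaussMixtureFDeriv v t ρ x) x :=
  (hasFDerivAt_gaussMixture hv x).log (gaussMixture_pos hv x).ne'

lemma hasFDerivAt_fderiv_log_gaussMixture [IsProbabilityMeasure ρ] (hv : 0 < v) (x : V) :
    HasFDerivAt (fun x => (gaussMixture v t ρ x)⁻¹ • gaussMixtureFDeriv v t ρ x)
      (logGaussMixtureFDeriv₂ v t ρ x) x :=
  (((hasDerivAt_inv (gaussMixture_pos hv x).ne').comp_hasFDerivAt x
    (hasFDerivAt_gaussMixture hv x))).smul (hasFDerivAt_fderiv_gaussMixture hv x)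

lemma integrable_gaussKernel_mul_inner [IsFiniteMeasure ρ] (hv : 0 < v) (x w : V) :
    Integrable (fun y => gaussKernel v (x - t • y) * inner ℝ (x - t • y) w) ρ := by
  refine Integrable.of_bound (Continuous.aestronglyMeasurable (by fun_prop)) ((1 + 2 * v) * ‖w‖)
    (.of_forall fun y => ?_)
  have h0 := gaussKernel_pos v (x - t • y)
  have h1 := gaussKernel_mul_sq_le hv (x - t • y)
  have h2 := gaussKernel_le_one hv (x - t • y)
  have h3 := norm_inner_le_norm (𝕜 := ℝ) (x - t • y) w
  rw [norm_mul, Real.norm_of_nonneg h0.le]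
  calc _ ≤ gaussKernel v (x - t • y) * (‖x - t • y‖ * ‖w‖) := by gcongr
    _ = (gaussKernel v (x - t • y) * ‖x - t • y‖) * ‖w‖ := by ring
    _ ≤ _ := by
      gcongr
      nlinarith [sq_nonneg (‖x - t • y‖ - 1)]

lemma integrable_gaussKernel_mul_inner_sq [IsFiniteMeasure ρ] (hv : 0 < v) (x w : V) :
    Integrable (fun y => gaussKernel v (x - t • y) * inner ℝ (x - t • y) w ^ 2) ρ := by
  refine Integrable.of_bound (Continuous.aestronglyMeasurable (by fun_prop)) ((2 * v) * ‖w‖ ^ 2)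
    (.of_forall fun y => ?_)
  have h0 := gaussKernel_pos v (x - t • y)
  have h1 := gaussKernel_mul_sq_le hv (x - t • y)
  have h3 := norm_inner_le_norm (𝕜 := ℝ) (x - t • y) w
  rw [norm_mul, Real.norm_of_nonneg h0.le, norm_pow]
  calc _ ≤ gaussKernel v (x - t • y) * (‖x - t • y‖ * ‖w‖) ^ 2 := by gcongr
    _ = (gaussKernel v (x - t • y) * ‖x - t • y‖ ^ 2) * ‖w‖ ^ 2 := by ring
    _ ≤ _ := by gcongr

lemma gaussMixtureFDeriv_apply [IsFiniteMeasure ρ] (hv : 0 < v) (x w : V) :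
    gaussMixtureFDeriv v t ρ x w =
      -(∫ y, gaussKernel v (x - t • y) * inner ℝ (x - t • y) w ∂ρ) / v := by
  unfold gaussMixtureFDeriv
  rw [ContinuousLinearMap.integral_apply, neg_div, ← integral_div, ← integral_neg]
  · congr 1 with y
    rw [gaussKernelFDeriv_apply, neg_div]
  · exact Integrable.of_bound (Continuous.aestronglyMeasurable (by fun_prop)) _
      (.of_forall fun y => norm_gaussKernelFDeriv_le hv _)

lemma gaussMixtureFDeriv₂_apply [IsFiniteMeasure ρ] (hv : 0 < v) (x w : V) :
    gaussMixtureFDeriv₂ v t ρ x w w =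
      (∫ y, gaussKernel v (x - t • y) * inner ℝ (x - t • y) w ^ 2 ∂ρ) / v ^ 2 -
        ‖w‖ ^ 2 / v * gaussMixture v t ρ x := by
  unfold gaussMixtureFDeriv₂ gaussMixture
  have hi : Integrable (fun y => gaussKernelFDeriv₂ v (x - t • y)) ρ :=
    Integrable.of_bound (Continuous.aestronglyMeasurable (by fun_prop)) _
      (.of_forall fun y => norm_gaussKernelFDeriv₂_le hv _)
  rw [ContinuousLinearMap.integral_apply hi,
    ContinuousLinearMap.integral_apply (hi.apply_continuousLinearMap w),
    ← integral_div, ← integral_const_mul, ← integral_sub]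
  · congr 1 with y
    rw [gaussKernelFDeriv₂_apply]
  · exact (integrable_gaussKernel_mul_inner_sq hv x w).div_const _
  · exact (integrable_gaussKernel hv x).const_mul _

/-- If the linear form `⟪w, ·⟫` oscillates by at most `r` around some value `ρ`-almost surely, the
Hessian of the logarithm of a Gaussian mixture is bounded in the direction `w`. -/
lemma logGaussMixtureFDeriv₂_le [IsProbabilityMeasure ρ] (hv : 0 < v) (x w : V) {m r : ℝ}
    (hr : ∀ᵐ y ∂ρ, |inner ℝ y w - m| ≤ r) :
    logGaussMixtureFDeriv₂ v t ρ x w w ≤ t ^ 2 * r ^ 2 / v ^ 2 - ‖w‖ ^ 2 / v := by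
  set g : V → ℝ := fun y => gaussKernel v (x - t • y) with hg
  set X : V → ℝ := fun y => inner ℝ (x - t • y) w with hX
  -- With this centre, `X y - c = -t (⟨y, w⟩ - m)`, so the oscillation hypothesis applies directly.
  set c : ℝ := inner ℝ x w - t * m with hc
  have hQ := gaussMixture_pos (t := t) (ρ := ρ) hv x
  have i0 : Integrable g ρ := integrable_gaussKernel hv x
  have i1 : Integrable (fun y => g y * X y) ρ := integrable_gaussKernel_mul_inner hv x w
  have i2 : Integrable (fun y => g y * X y ^ 2) ρ := integrable_gaussKernel_mul_inner_sq hv x w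
  set I1 := ∫ y, g y * X y ∂ρ with hI1
  set I2 := ∫ y, g y * X y ^ 2 ∂ρ with hI2
  set Q := gaussMixture v t ρ x with hQdef
  have hcentre : ∫ y, g y * (X y - c) ^ 2 ∂ρ = I2 - 2 * c * I1 + c ^ 2 * Q := by
    have h1 : Integrable (fun y => g y * X y ^ 2 - 2 * c * (g y * X y)) ρ :=
      i2.sub (i1.const_mul _)
    have h2 : Integrable (fun y => c ^ 2 * g y) ρ := i0.const_mul _
    rw [hI2, hI1, hQdef, gaussMixture, ← integral_const_mul, ← integral_const_mul,
      ← integral_sub i2 (i1.const_mul _), ← integral_add h1 h2]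
    congr 1 with y
    ring
  have hosc : ∫ y, g y * (X y - c) ^ 2 ∂ρ ≤ (t ^ 2 * r ^ 2) * Q := by
    rw [hQdef, gaussMixture, ← integral_const_mul]
    refine integral_mono_ae ?_ (i0.const_mul _) ?_
    · have : Integrable (fun y => g y * X y ^ 2 - 2 * c * (g y * X y) + c ^ 2 * g y) ρ :=
        (i2.sub (i1.const_mul _)).add (i0.const_mul _)
      refine this.congr (.of_forall fun y => ?_)
      ring
    · filter_upwards [hr] with y hy
      have e : X y - c = -t * (inner ℝ y w - m) := by
        simp only [hX, hc, inner_sub_left, inner_smul_left, conj_trivial]; ring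
      have h1 : (inner ℝ y w - m) ^ 2 ≤ r ^ 2 := by
        rw [← sq_abs]; exact pow_le_pow_left₀ (abs_nonneg _) hy 2
      have h2 : 0 < g y := gaussKernel_pos v _
      have h3 : (X y - c) ^ 2 ≤ t ^ 2 * r ^ 2 := by
        rw [e, mul_pow, neg_sq]; gcongr
      calc g y * (X y - c) ^ 2 ≤ g y * (t ^ 2 * r ^ 2) := by gcongr
        _ = _ := mul_comm _ _
  -- The first term is the variance of `X` under the normalised weight `g / Q`, divided by `v²`.
  have hval : logGaussMixtureFDeriv₂ v t ρ x w w
      = (I2 * Q - I1 ^ 2) / (Q ^ 2 * v ^ 2) - ‖w‖ ^ 2 / v := by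
    simp only [logGaussMixtureFDeriv₂, add_apply, smul_apply,
      ContinuousLinearMap.smulRight_apply, smul_eq_mul, gaussMixtureFDeriv₂_apply hv,
      gaussMixtureFDeriv_apply hv, ← hQdef]
    change Q⁻¹ * (I2 / v ^ 2 - ‖w‖ ^ 2 / v * Q) + -(Q ^ 2)⁻¹ * (-I1 / v) * (-I1 / v) = _
    field_simp
    ring
  rw [hval]
  refine sub_le_sub_right ?_ _
  rw [div_le_div_iff₀ (by positivity) (by positivity)]
  -- Variance is at most the second moment about `c`: the difference, scaled by `Q²`, is `(I1 - c
  -- Q)²`.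
  have : I2 * Q - I1 ^ 2 ≤ t ^ 2 * r ^ 2 * Q ^ 2 := by
    rw [hcentre] at hosc
    nlinarith [sq_nonneg (I1 - c * Q), mul_le_mul_of_nonneg_right hosc hQ.le]
  have hv2 : 0 < v ^ 2 := by positivity
  nlinarith [mul_le_mul_of_nonneg_right this hv2.le]

end Mixture

end Gaussian

/-! ### The Prékopa–Leindler inequality -/

/-- The one-dimensional Brunn–Minkowski inequality for compact sets. -/
lemma volume_add_volume_le_of_isCompact {A B S : Set ℝ} (hA : IsCompact A) (hB : IsCompact B)
    (hA0 : A.Nonempty) (hB0 : B.Nonempty)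
    (h : ∀ x ∈ A, ∀ y ∈ B, (1 / 2 : ℝ) • (x + y) ∈ S) :
    volume A + volume B ≤ 2 * volume S := by
  set a := sSup A
  set b := sInf B
  have ha : a ∈ A := hA.sSup_mem hA0
  have hb : b ∈ B := hB.sInf_mem hB0
  -- The half-size copies `(A + b)/2` and `(a + B)/2` both lie in `S`. The first is to the left of
  -- `(a + b)/2` and the second to its right, so they overlap in at most one point and their
  -- measures add.
  set P := AffineMap.homothety b (1 / 2 : ℝ) '' A
  set R := AffineMap.homothety a (1 / 2 : ℝ) '' B
  have hP : volume P = 2⁻¹ * volume A := by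
    rw [Measure.addHaar_image_homothety]
    congr 1
    rw [Module.finrank_self, pow_one, abs_of_pos (by norm_num), one_div,
      ENNReal.ofReal_inv_of_pos (by norm_num)]
    simp
  have hR : volume R = 2⁻¹ * volume B := by
    rw [Measure.addHaar_image_homothety]
    congr 1
    rw [Module.finrank_self, pow_one, abs_of_pos (by norm_num), one_div,
      ENNReal.ofReal_inv_of_pos (by norm_num)]
    simp
  have hhom : ∀ u v : ℝ, AffineMap.homothety u (1 / 2 : ℝ) v = (1 / 2 : ℝ) • (v + u) := by
    intro u v
    simp only [AffineMap.homothety_apply, vsub_eq_sub, smul_eq_mul, vadd_eq_add]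
    ring
  have hdisj : AEDisjoint volume P R := by
    refine measure_mono_null (t := {(1 / 2 : ℝ) • (a + b)}) ?_ (measure_singleton _)
    rintro _ ⟨⟨x, hx, rfl⟩, ⟨y, hy, hxy⟩⟩
    have h1 : x ≤ a := le_csSup hA.bddAbove hx
    have h2 : b ≤ y := csInf_le hB.bddBelow hy
    rw [hhom, hhom] at hxy
    simp only [smul_eq_mul] at hxy
    simp only [Set.mem_singleton_iff, hhom, smul_eq_mul]
    linarith
  have hRm : MeasurableSet R := (hB.image (AffineMap.continuous_of_finiteDimensional _)).measurableSet
  have hsub : P ∪ R ⊆ S := by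
    rintro _ (⟨x, hx, rfl⟩ | ⟨y, hy, rfl⟩)
    · rw [hhom]; exact h x hx b hb
    · rw [hhom, add_comm]; exact h a ha y hy
  calc volume A + volume B = 2 * (volume P + volume R) := by
        rw [hP, hR, mul_add, ← mul_assoc, ← mul_assoc, ENNReal.mul_inv_cancel (by simp) (by simp),
          one_mul, one_mul]
    _ = 2 * volume (P ∪ R) := by rw [measure_union₀ hRm.nullMeasurableSet hdisj]
    _ ≤ 2 * volume S := by gcongr

/-- The one-dimensional Brunn–Minkowski inequality. -/
lemma volume_add_volume_le {A B S : Set ℝ} (hA : MeasurableSet A) (hB : MeasurableSet B)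
    (hA0 : A.Nonempty) (hB0 : B.Nonempty)
    (h : ∀ x ∈ A, ∀ y ∈ B, (1 / 2 : ℝ) • (x + y) ∈ S) :
    volume A + volume B ≤ 2 * volume S := by
  obtain ⟨a, ha⟩ := hA0
  obtain ⟨b, hb⟩ := hB0
  rw [hA.measure_eq_iSup_isCompact, hB.measure_eq_iSup_isCompact]
  simp only [iSup_and']
  refine ENNReal.biSup_add_biSup_le' (p := fun K => K ⊆ A ∧ IsCompact K)
    (q := fun K => K ⊆ B ∧ IsCompact K) ⟨∅, by simp⟩ ⟨∅, by simp⟩ ?_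
  rintro K ⟨hKA, hK⟩ L ⟨hLB, hL⟩
  -- The approximating compact sets may be empty; adding a fixed point makes the compact case
  -- applicable.
  have hKA' : insert a K ⊆ A := Set.insert_subset ha hKA
  have hLB' : insert b L ⊆ B := Set.insert_subset hb hLB
  calc volume K + volume L ≤ volume (insert a K) + volume (insert b L) := by
        gcongr <;> exact Set.subset_insert _ _
    _ ≤ 2 * volume S := volume_add_volume_le_of_isCompact (hK.insert a) (hL.insert b)
        (Set.insert_nonempty _ _) (Set.insert_nonempty _ _)
        fun x hx y hy => h x (hKA' hx) y (hLB' hy)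

/-- The one-dimensional Prékopa–Leindler inequality, for functions with supremum one. -/
lemma lintegral_add_lintegral_le {f g h : ℝ → ℝ} (hf : Measurable f) (hg : Measurable g)
    (hh : Measurable h) (hf0 : 0 ≤ f) (hg0 : 0 ≤ g) (hh0 : 0 ≤ h) (hf1 : ∀ x, f x ≤ 1)
    (hg1 : ∀ x, g x ≤ 1) (hfs : ∀ l < 1, ∃ x, l < f x) (hgs : ∀ l < 1, ∃ x, l < g x)
    (hfg : ∀ x y, f x * g y ≤ h ((1 / 2 : ℝ) • (x + y)) ^ 2) :
    (∫⁻ x, ENNReal.ofReal (f x)) + ∫⁻ x, ENNReal.ofReal (g x)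
      ≤ 2 * ∫⁻ x, ENNReal.ofReal (h x) := by
  -- Layer-cake formula: for each level `l`, midpoints of `{f > l}` and `{g > l}` lie in `{h > l}`.
  -- Supremum one makes both sets nonempty for every `l < 1`, as Brunn–Minkowski requires, and for
  -- `l ≥ 1` both are empty.
  rw [lintegral_eq_lintegral_meas_lt volume (.of_forall hf0) hf.aemeasurable,
    lintegral_eq_lintegral_meas_lt volume (.of_forall hg0) hg.aemeasurable,
    lintegral_eq_lintegral_meas_lt volume (.of_forall hh0) hh.aemeasurable,
    ← lintegral_const_mul' _ _ (by simp), ← lintegral_add_left]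
  · refine setLIntegral_mono' measurableSet_Ioi fun l (hl : 0 < l) => ?_
    rcases lt_or_ge l 1 with hl1 | hl1
    · refine volume_add_volume_le (measurableSet_lt measurable_const hf)
        (measurableSet_lt measurable_const hg) (hfs l hl1) (hgs l hl1) fun x hx y hy => ?_
      simp only [Set.mem_ofPred_eq] at hx hy ⊢
      refine lt_of_pow_lt_pow_left₀ 2 (hh0 _) ?_
      nlinarith [hfg x y]
    · have h1 : {a | l < f a} = ∅ := by
        ext x; simpa using (hf1 x).trans hl1
      have h2 : {a | l < g a} = ∅ := by
        ext x; simpa using (hg1 x).trans hl1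
      simp [h1, h2]
  · exact Antitone.measurable fun a b hab => measure_mono fun x hx => lt_of_le_of_lt hab hx

/-- AM–GM, which turns the additive inequality for normalised functions into the multiplicative one.
-/
lemma mul_le_sq_of_add_le_two_mul {x y z : ℝ≥0∞} (h : x + y ≤ 2 * z) : x * y ≤ z ^ 2 := by
  rcases eq_or_ne z ⊤ with rfl | hz
  · simp
  have hxy : x + y ≠ ⊤ := ne_top_of_le_ne_top (ENNReal.mul_ne_top (by simp) hz) h
  have hx : x ≠ ⊤ := fun hx => by simp [hx] at hxy
  have hy : y ≠ ⊤ := fun hy => by simp [hy] at hxy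
  lift x to NNReal using hx
  lift y to NNReal using hy
  lift z to NNReal using hz
  norm_cast at h ⊢
  rw [← NNReal.coe_le_coe] at h ⊢
  push_cast at h ⊢
  nlinarith [sq_nonneg ((x : ℝ) - y), x.coe_nonneg, y.coe_nonneg, z.coe_nonneg]

/-- The one-dimensional Prékopa–Leindler inequality, for bounded functions. -/
lemma lintegral_mul_lintegral_le_of_bounded {f g h : ℝ → ℝ} (hf : Measurable f)
    (hg : Measurable g) (hh : Measurable h) (hf0 : 0 ≤ f) (hg0 : 0 ≤ g) (hh0 : 0 ≤ h)
    (hfb : BddAbove (Set.range f)) (hgb : BddAbove (Set.range g))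
    (hfg : ∀ x y, f x * g y ≤ h ((1 / 2 : ℝ) • (x + y)) ^ 2) :
    (∫⁻ x, ENNReal.ofReal (f x)) * ∫⁻ x, ENNReal.ofReal (g x)
      ≤ (∫⁻ x, ENNReal.ofReal (h x)) ^ 2 := by
  set a := ⨆ x, f x
  set b := ⨆ x, g x
  have hfa : ∀ x, f x ≤ a := fun x => le_ciSup hfb x
  have hgb' : ∀ x, g x ≤ b := fun x => le_ciSup hgb x
  rcases (show 0 ≤ a from (hf0 0).trans (hfa 0)).eq_or_lt with ha | ha
  · have : ∀ x, f x = 0 := fun x => le_antisymm (ha ▸ hfa x) (hf0 x)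
    simp [this]
  rcases (show 0 ≤ b from (hg0 0).trans (hgb' 0)).eq_or_lt with hb | hb
  · have : ∀ x, g x = 0 := fun x => le_antisymm (hb ▸ hgb' x) (hg0 x)
    simp [this]
  -- Scaling `h` by the geometric mean of the two suprema preserves the pointwise hypothesis.
  set c := √(a * b)
  have hc : 0 < c := Real.sqrt_pos.2 (by positivity)
  have hc2 : c ^ 2 = a * b := Real.sq_sqrt (by positivity)
  have key := lintegral_add_lintegral_le (f := fun x => f x / a) (g := fun x => g x / b)
    (h := fun x => h x / c) (hf.div_const _) (hg.div_const _) (hh.div_const _)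
    (fun x => div_nonneg (hf0 x) ha.le) (fun x => div_nonneg (hg0 x) hb.le)
    (fun x => div_nonneg (hh0 x) hc.le) (fun x => (div_le_one ha).2 (hfa x))
    (fun x => (div_le_one hb).2 (hgb' x))
    (fun l hl => by
      obtain ⟨x, hx⟩ := exists_lt_of_lt_ciSup (show l * a < ⨆ x, f x by nlinarith)
      exact ⟨x, (lt_div_iff₀ ha).2 hx⟩)
    (fun l hl => by
      obtain ⟨x, hx⟩ := exists_lt_of_lt_ciSup (show l * b < ⨆ x, g x by nlinarith)
      exact ⟨x, (lt_div_iff₀ hb).2 hx⟩)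
    (fun x y => by
      rw [div_mul_div_comm, div_pow, hc2]
      exact div_le_div_of_nonneg_right (hfg x y) (by positivity))
  have hscale : ∀ (u : ℝ → ℝ) (r : ℝ), 0 < r → ∫⁻ x, ENNReal.ofReal (u x) =
      ENNReal.ofReal r * ∫⁻ x, ENNReal.ofReal (u x / r) := by
    intro u r hr
    rw [← lintegral_const_mul' _ _ (by simp)]
    refine lintegral_congr fun x => ?_
    rw [← ENNReal.ofReal_mul hr.le, mul_div_cancel₀ _ hr.ne']
  rw [hscale f a ha, hscale g b hb, hscale h c hc, mul_mul_mul_comm, mul_pow,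
    ← ENNReal.ofReal_mul ha.le, ← ENNReal.ofReal_pow hc.le, hc2]
  gcongr
  exact mul_le_sq_of_add_le_two_mul key

/-- The midpoint case of the Prékopa–Leindler inequality holds in `α`. -/
def PrekopaLeindler (α : Type*) [MeasureSpace α] [AddCommGroup α] [Module ℝ α] : Prop :=
  ∀ f g h : α → ℝ≥0∞, Measurable f → Measurable g → Measurable h →
    (∀ x y, f x * g y ≤ h ((1 / 2 : ℝ) • (x + y)) ^ 2) →
      (∫⁻ x, f x) * ∫⁻ x, g x ≤ (∫⁻ x, h x) ^ 2

/-- Truncation at integer heights and monotone convergence reduce to bounded functions. -/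
lemma prekopaLeindler_real : PrekopaLeindler ℝ := by
  intro f g h hf hg hh hfg
  have hsup : ∀ u : ℝ → ℝ≥0∞, Measurable u →
      ∫⁻ x, u x = ⨆ n : ℕ, ∫⁻ x, min (u x) n := by
    intro u hu
    rw [← lintegral_iSup (fun n => hu.min measurable_const)
      fun m n hmn x => min_le_min_left _ (by exact_mod_cast hmn)]
    refine lintegral_congr fun x => ?_
    rw [← inf_iSup_eq, ENNReal.iSup_natCast, inf_top_eq]
  rw [hsup f hf, hsup g hg, ENNReal.iSup_mul]
  refine iSup_le fun n => ?_
  rw [ENNReal.mul_iSup]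
  refine iSup_le fun m => ?_
  -- Truncating `h` at `N` is harmless: where `h ≥ N`, the product of the truncated `f` and `g` is
  -- at most `n m ≤ N²`.
  set N := max n m
  have htop : ∀ (u : ℝ → ℝ≥0∞) (k : ℕ) x, min (u x) k ≠ ⊤ := fun u k x =>
    ne_top_of_le_ne_top (ENNReal.natCast_ne_top k) (min_le_right _ _)
  have hle : ∀ (u : ℝ → ℝ≥0∞) (k : ℕ) x, (min (u x) k).toReal ≤ k := fun u k x => by
    simpa using ENNReal.toReal_mono (ENNReal.natCast_ne_top k) (min_le_right (u x) k)
  have hof : ∀ (u : ℝ → ℝ≥0∞) (k : ℕ),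
      ∫⁻ x, min (u x) k = ∫⁻ x, ENNReal.ofReal (min (u x) k).toReal := fun u k =>
    lintegral_congr fun x => (ENNReal.ofReal_toReal (htop u k x)).symm
  calc (∫⁻ x, min (f x) n) * ∫⁻ x, min (g x) m ≤ (∫⁻ x, min (h x) N) ^ 2 := by
        rw [hof, hof, hof]
        refine lintegral_mul_lintegral_le_of_bounded (hf.min measurable_const).ennreal_toReal
          (hg.min measurable_const).ennreal_toReal (hh.min measurable_const).ennreal_toReal
          (fun _ => ENNReal.toReal_nonneg) (fun _ => ENNReal.toReal_nonneg)
          (fun _ => ENNReal.toReal_nonneg) ⟨n, ?_⟩ ⟨m, ?_⟩ fun x y => ?_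
        · rintro _ ⟨x, rfl⟩; exact hle f n x
        · rintro _ ⟨x, rfl⟩; exact hle g m x
        · rw [← ENNReal.toReal_mul, ← ENNReal.toReal_pow]
          refine ENNReal.toReal_mono (ENNReal.pow_ne_top (htop h N _)) ?_
          rcases le_total (h ((1 / 2 : ℝ) • (x + y))) N with hN | hN
          · rw [min_eq_left hN]
            exact (mul_le_mul' (min_le_left _ _) (min_le_left _ _)).trans (hfg x y)
          · rw [min_eq_right hN, sq]
            exact mul_le_mul' ((min_le_right _ _).trans (by exact_mod_cast le_max_left n m))
              ((min_le_right _ _).trans (by exact_mod_cast le_max_right n m))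
    _ ≤ (∫⁻ x, h x) ^ 2 := by gcongr; exact min_le_left _ _

/-- Tensorisation by Fubini: the inequality on the fibres over `a` and `b` is precisely the
pointwise hypothesis for the partial integrals. -/
lemma PrekopaLeindler.prod {α β : Type*} [MeasureSpace α] [AddCommGroup α] [Module ℝ α]
    [MeasureSpace β] [AddCommGroup β] [Module ℝ β] [SFinite (volume : Measure α)]
    [SFinite (volume : Measure β)] (hα : PrekopaLeindler α) (hβ : PrekopaLeindler β) :
    PrekopaLeindler (α × β) := by
  intro f g h hf hg hh hfg
  simp only [Measure.volume_eq_prod]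
  rw [lintegral_prod _ hf.aemeasurable, lintegral_prod _ hg.aemeasurable,
    lintegral_prod _ hh.aemeasurable]
  refine hα _ _ _ hf.lintegral_prod_right' hg.lintegral_prod_right' hh.lintegral_prod_right'
    fun a b => ?_
  exact hβ _ _ _ (by fun_prop) (by fun_prop) (by fun_prop) fun x y => hfg (a, x) (b, y)

lemma PrekopaLeindler.of_measurePreserving {α β : Type*} [MeasureSpace α] [AddCommGroup α]
    [Module ℝ α] [MeasureSpace β] [AddCommGroup β] [Module ℝ β] (hα : PrekopaLeindler α)
    (e : α → β) (he : MeasurePreserving e)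
    (hmid : ∀ x y, e ((1 / 2 : ℝ) • (x + y)) = (1 / 2 : ℝ) • (e x + e y)) :
    PrekopaLeindler β := by
  intro f g h hf hg hh hfg
  rw [← he.lintegral_comp hf, ← he.lintegral_comp hg, ← he.lintegral_comp hh]
  refine hα _ _ _ (hf.comp he.measurable) (hg.comp he.measurable) (hh.comp he.measurable)
    fun x y => ?_
  rw [hmid]
  exact hfg _ _

lemma prekopaLeindler_pi : ∀ n : ℕ, PrekopaLeindler (Fin n → ℝ)
  | 0 => by
    intro f g h hf hg hh hfg
    simp only [lintegral_unique, Measure.volume_pi_eq_dirac (0 : Fin 0 → ℝ), measure_univ, mul_one]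
    convert hfg default default
  | n + 1 => by
    refine (prekopaLeindler_real.prod (prekopaLeindler_pi n)).of_measurePreserving _
      (volume_preserving_piFinSuccAbove (fun _ => ℝ) 0).symm fun x y => ?_
    ext i
    refine Fin.cases ?_ (fun j => ?_) i <;>
      simp [MeasurableEquiv.piFinSuccAbove, Fin.insertNthEquiv, mul_add]

/-- The midpoint case of the Prékopa–Leindler inequality in Euclidean space. -/
theorem prekopaLeindler_euclidean (d : ℕ) : PrekopaLeindler (E d) :=
  (prekopaLeindler_pi d).of_measurePreserving _ (PiLp.volume_preserving_toLp (Fin d))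
    fun x y => by ext; simp [mul_add]

/-! ### Log-concavity of Gaussian mixtures of semi-log-concave measures -/

section Convexity

variable {V : Type*} [NormedAddCommGroup V] [InnerProductSpace ℝ V]

/-- A lower bound on the Hessian yields quantitative midpoint convexity. -/
lemma midpoint_le_of_hessian_ge {U : V → ℝ} {S : Set V} {κ : ℝ} (hS : IsOpen S)
    (hc : Convex ℝ S) (hU : ContDiffOn ℝ 2 U S)
    (hκ : ∀ x ∈ S, ∀ v : V, κ * ‖v‖ ^ 2 ≤ fderiv ℝ (fderiv ℝ U) x v v)
    {y z : V} (hy : y ∈ S) (hz : z ∈ S) :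
    2 * U ((1 / 2 : ℝ) • (y + z)) + κ / 4 * ‖z - y‖ ^ 2 ≤ U y + U z := by
  set w := z - y with hw
  set c : ℝ → V := fun τ => y + τ • w with hcdef
  have hcS : ∀ τ ∈ Set.Icc (0 : ℝ) 1, c τ ∈ S := fun τ hτ => by
    exact hc.add_smul_sub_mem hy hz hτ
  have hcd : ∀ τ, HasDerivAt c w τ := fun τ => by
    simpa [hcdef] using ((hasDerivAt_id τ).smul_const w).const_add y
  have hd1 : ∀ τ ∈ Set.Icc (0 : ℝ) 1, HasDerivAt (fun τ => U (c τ)) (fderiv ℝ U (c τ) w) τ := by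
    intro τ hτ
    have h1 := (hU.contDiffAt (hS.mem_nhds (hcS τ hτ))).differentiableAt (by norm_num)
    exact h1.hasFDerivAt.comp_hasDerivAt τ (hcd τ)
  have hd2 : ∀ τ ∈ Set.Icc (0 : ℝ) 1, HasDerivAt (fun τ => fderiv ℝ U (c τ) w)
      (fderiv ℝ (fderiv ℝ U) (c τ) w w) τ := by
    intro τ hτ
    have h1 := ((hU.contDiffAt (hS.mem_nhds (hcS τ hτ))).fderiv_right (m := 1)
      (by norm_num)).differentiableAt (by norm_num)
    have h2 := h1.hasFDerivAt.comp_hasDerivAt τ (hcd τ)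
    simpa using h2.clm_apply (hasDerivAt_const τ w)
  set a := κ * ‖w‖ ^ 2 with ha
  have hq : ∀ τ : ℝ, HasDerivAt (fun τ : ℝ => a / 2 * τ ^ 2) (a * τ) τ := fun τ => by
    convert! ((hasDerivAt_id τ).pow 2).const_mul (a / 2) using 1
    simp; ring
  have hq' : ∀ τ : ℝ, HasDerivAt (fun τ : ℝ => a * τ) a τ := fun τ => by
    simpa using (hasDerivAt_id τ).const_mul a
  -- Along the segment, the Hessian bound says that `U` minus a parabola is convex; the midpoint
  -- defect of the parabola produces the constant `κ / 4`.
  have hconv : ConvexOn ℝ (Set.Icc (0 : ℝ) 1) fun τ => U (c τ) - a / 2 * τ ^ 2 := by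
    refine convexOn_of_hasDerivWithinAt2_nonneg (convex_Icc _ _)
      (f' := fun τ => fderiv ℝ U (c τ) w - a * τ)
      (f'' := fun τ => fderiv ℝ (fderiv ℝ U) (c τ) w w - a) ?_ ?_ ?_ ?_
    · exact fun τ hτ => ((hd1 τ hτ).sub (hq τ)).continuousAt.continuousWithinAt
    · exact fun τ hτ => ((hd1 τ (interior_subset hτ)).sub (hq τ)).hasDerivWithinAt
    · exact fun τ hτ => ((hd2 τ (interior_subset hτ)).sub (hq' τ)).hasDerivWithinAt
    · exact fun τ hτ => sub_nonneg.2 (hκ _ (hcS τ (interior_subset hτ)) w)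
  have key := hconv.2 (Set.left_mem_Icc.2 zero_le_one) (Set.right_mem_Icc.2 zero_le_one)
    (show (0 : ℝ) ≤ 1 / 2 by norm_num) (show (0 : ℝ) ≤ 1 / 2 by norm_num) (by norm_num)
  have e0 : c 0 = y := by simp [hcdef]
  have e1 : c 1 = z := by simp [hcdef, hw]
  have e2 : c (1 / 2) = (1 / 2 : ℝ) • (y + z) := by
    simp only [hcdef, hw]; module
  simp only [smul_eq_mul, mul_zero, mul_one, zero_add, e0, e1, e2] at key
  linarith

/-- A midpoint inequality yields an upper bound on the Hessian. -/
lemma hessian_le_of_midpoint {L : V → ℝ} {L' : V → V →L[ℝ] ℝ} {L'' : V →L[ℝ] V →L[ℝ] ℝ}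
    {x w : V} {c : ℝ} (h1 : ∀ y, HasFDerivAt L (L' y) y) (h2 : HasFDerivAt L' L'' x)
    (hmid : ∀ h : ℝ, L (x + h • w) + L (x - h • w) - 2 * L x ≤ c * h ^ 2) : L'' w w ≤ c := by
  -- If `L'' w w > c`, then `φ = ψ'` vanishes at `0` with positive derivative there, so it is
  -- positive just to the right. The mean value theorem gives `ψ ε > ψ 0` for a small `ε`, against
  -- the midpoint inequality.
  by_contra! hlt
  set ψ : ℝ → ℝ := fun h => L (x + h • w) + L (x - h • w) - c * h ^ 2 with hψ
  set φ : ℝ → ℝ := fun h => L' (x + h • w) w - L' (x - h • w) w - 2 * c * h with hφ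
  have hp : ∀ h : ℝ, HasDerivAt (fun h : ℝ => x + h • w) w h := fun h => by
    simpa using ((hasDerivAt_id h).smul_const w).const_add x
  have hm : ∀ h : ℝ, HasDerivAt (fun h : ℝ => x - h • w) (-w) h := fun h => by
    simpa using ((hasDerivAt_id h).smul_const w).const_sub x
  have hψ' : ∀ h, HasDerivAt ψ (φ h) h := fun h => by
    have e1 : HasDerivAt (fun h : ℝ => L (x + h • w)) (L' (x + h • w) w) h :=
      (h1 (x + h • w)).comp_hasDerivAt h (hp h)
    have e2 : HasDerivAt (fun h : ℝ => L (x - h • w)) (L' (x - h • w) (-w)) h :=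
      (h1 (x - h • w)).comp_hasDerivAt h (hm h)
    have e3 : HasDerivAt (fun h : ℝ => c * h ^ 2) (c * (2 * h)) h := by
      simpa using (hasDerivAt_pow 2 h).const_mul c
    exact ((e1.add e2).sub e3).congr_deriv (by simp only [hφ, map_neg]; ring)
  have hφ' : HasDerivAt φ (2 * (L'' w w - c)) 0 := by
    have h2p : HasFDerivAt L' L'' (x + (0 : ℝ) • w) := by simpa using h2
    have h2m : HasFDerivAt L' L'' (x - (0 : ℝ) • w) := by simpa using h2
    have e1 : HasDerivAt (fun h : ℝ => L' (x + h • w) w) (L'' w w) 0 := by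
      have e : HasDerivAt (fun h : ℝ => L' (x + h • w)) (L'' (w)) 0 :=
        HasFDerivAt.comp_hasDerivAt (f := fun h : ℝ => x + h • w) 0 h2p (hp 0)
      simpa using e.clm_apply (hasDerivAt_const (0 : ℝ) w)
    have e2 : HasDerivAt (fun h : ℝ => L' (x - h • w) w) (-L'' w w) 0 := by
      have e : HasDerivAt (fun h : ℝ => L' (x - h • w)) (L'' (-w)) 0 :=
        HasFDerivAt.comp_hasDerivAt (f := fun h : ℝ => x - h • w) 0 h2m (hm 0)
      simpa using e.clm_apply (hasDerivAt_const (0 : ℝ) w)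
    have e3 : HasDerivAt (fun h : ℝ => 2 * c * h) (2 * c) 0 := by
      simpa using (hasDerivAt_id (0 : ℝ)).const_mul (2 * c)
    exact ((e1.sub e2).sub e3).congr_deriv (by ring)
  have hpos : ∀ᶠ h in nhdsWithin (0 : ℝ) (Set.Ioi 0), 0 < φ h := by
    have hs := (hasDerivAt_iff_tendsto_slope.1 hφ').eventually_const_lt
      (show (0 : ℝ) < 2 * (L'' w w - c) by linarith)
    have hs' := hs.filter_mono (nhdsWithin_mono (0 : ℝ)
      (show Set.Ioi (0 : ℝ) ⊆ {0}ᶜ from fun h (hh : 0 < h) => hh.ne'))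
    filter_upwards [hs', self_mem_nhdsWithin] with h hh (h0 : 0 < h)
    have hφ0 : φ 0 = 0 := by simp [hφ]
    rw [slope_def_field, hφ0, sub_zero, sub_zero] at hh
    exact (div_pos_iff_of_pos_right h0).1 hh
  obtain ⟨ε, hε, hεpos⟩ := mem_nhdsGT_iff_exists_Ioo_subset.1 hpos
  simp only [Set.mem_Ioi] at hε
  obtain ⟨ξ, hξ, hslope⟩ := exists_hasDerivAt_eq_slope ψ φ hε
    (fun h _ => (hψ' h).continuousAt.continuousWithinAt) fun h _ => hψ' h
  have h3 : 0 < φ ξ := hεpos hξ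
  rw [hslope, sub_zero, div_pos_iff_of_pos_right hε] at h3
  have h4 := hmid ε
  simp only [hψ, zero_smul, add_zero, sub_zero] at h3
  linarith

end Convexity

lemma HasPotential.volume_frontier {ν : Measure (E d)} {U : E d → ℝ} (h : HasPotential ν U) :
    volume (frontier ν.support) = 0 := h.convex_support.addHaar_frontier _

/-- Convexity makes the boundary of the support Lebesgue-null, so only the open interior, where `U`
is regular, matters. -/
lemma HasPotential.density_ae_eq {ν : Measure (E d)} {U : E d → ℝ} (h : HasPotential ν U) :
    density ν U =ᵐ[volume] (interior ν.support).indicator fun x => Real.exp (-U x) := by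
  have : ∀ᵐ y ∂(volume : Measure (E d)), y ∉ frontier ν.support := by
    simpa [ae_iff] using h.volume_frontier
  filter_upwards [this] with y hy
  by_cases hy' : y ∈ interior ν.support
  · simp [density, hy', interior_subset hy']
  · have : y ∉ ν.support := fun hs => hy ⟨subset_closure hs, hy'⟩
    simp [density, hy', this]

lemma HasPotential.aemeasurable_density {ν : Measure (E d)} {U : E d → ℝ}
    (h : HasPotential ν U) : AEMeasurable (density ν U) := by
  classical
  have hc : ContinuousOn (fun x => Real.exp (-U x)) (interior ν.support) :=
    h.contDiffOn.continuousOn.neg.rexp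
  exact (hc.measurable_piecewise continuousOn_const
    isOpen_interior.measurableSet).aemeasurable.congr h.density_ae_eq.symm

/-- Puts the mixture in the form that Prékopa–Leindler needs: a Lebesgue integral of an extended
nonnegative function vanishing off an open convex set. -/
lemma HasPotential.ofReal_gaussMixture {ν : Measure (E d)} [IsProbabilityMeasure ν] {U : E d → ℝ}
    (h : HasPotential ν U) {v t : ℝ} (hv : 0 < v) (x : E d) :
    ENNReal.ofReal (gaussMixture v t ν x) = ∫⁻ y, (interior ν.support).indicator
      (fun y => ENNReal.ofReal (Real.exp (-U y) * gaussKernel v (x - t • y))) y := by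
  unfold gaussMixture
  rw [ofReal_integral_eq_lintegral_ofReal (integrable_gaussKernel hv x)
    (.of_forall fun y => (gaussKernel_pos v _).le)]
  conv_lhs => rw [h.eq_withDensity]
  have hg : Measurable fun y : E d => ENNReal.ofReal (gaussKernel v (x - t • y)) :=
    (Continuous.measurable (by fun_prop)).ennreal_ofReal
  rw [lintegral_withDensity_eq_lintegral_mul₀ h.aemeasurable_density.ennreal_ofReal
    hg.aemeasurable]
  refine lintegral_congr_ae ?_
  filter_upwards [h.density_ae_eq] with y hy
  simp only [Pi.mul_apply, hy]
  by_cases hy' : y ∈ interior ν.support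
  · simp only [Set.indicator_of_mem hy', ← ENNReal.ofReal_mul (Real.exp_pos _).le]
  · simp [hy']

lemma HasPotential.measurable_indicator {ν : Measure (E d)} {U : E d → ℝ}
    (h : HasPotential ν U) (v t : ℝ) (x : E d) :
    Measurable ((interior ν.support).indicator
      fun y => ENNReal.ofReal (Real.exp (-U y) * gaussKernel v (x - t • y))) := by
  classical
  have hc : ContinuousOn (fun y => Real.exp (-U y) * gaussKernel v (x - t • y))
      (interior ν.support) :=
    h.contDiffOn.continuousOn.neg.rexp.mul (Continuous.continuousOn (by fun_prop))
  exact (ENNReal.continuous_ofReal.comp_continuousOn hc).measurable_piecewise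
    continuousOn_const isOpen_interior.measurableSet

/-- By the parallelogram law, only the quadratic form in the differences `a`, `b` of the endpoints
has to be controlled. Minimising `‖a - t b‖² / v + κ ‖b‖²` over `b` gives exactly `κ / (t² + κ v)
‖a‖²`, the Schur complement; positivity of the denominator makes the minimum exist, also for
negative `κ`. -/
lemma gaussian_exponent_midpoint_le {V : Type*} [NormedAddCommGroup V] [InnerProductSpace ℝ V]
    {v t κ : ℝ} (hv : 0 < v) (hden : 0 < t ^ 2 + κ * v) (x₁ x₂ y₁ y₂ : V) {u₁ u₂ u : ℝ}
    (hu : 2 * u + κ / 4 * ‖y₂ - y₁‖ ^ 2 ≤ u₁ + u₂) :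
    (κ / (t ^ 2 + κ * v) * ‖x₁‖ ^ 2 / 2 + (-u₁ + -‖x₁ - t • y₁‖ ^ 2 / (2 * v))) +
      (κ / (t ^ 2 + κ * v) * ‖x₂‖ ^ 2 / 2 + (-u₂ + -‖x₂ - t • y₂‖ ^ 2 / (2 * v))) ≤
    2 * (κ / (t ^ 2 + κ * v) * ‖(1 / 2 : ℝ) • (x₁ + x₂)‖ ^ 2 / 2 +
      (-u + -‖(1 / 2 : ℝ) • (x₁ + x₂) - t • (1 / 2 : ℝ) • (y₁ + y₂)‖ ^ 2 / (2 * v))) := by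
  set α := κ / (t ^ 2 + κ * v) with hα
  have par : ∀ a b : V, ‖a‖ ^ 2 + ‖b‖ ^ 2 = 2 * ‖(1 / 2 : ℝ) • (a + b)‖ ^ 2 + ‖b - a‖ ^ 2 / 2 := by
    intro a b
    have := parallelogram_law_with_norm ℝ b a
    rw [norm_smul, mul_pow, add_comm a b]
    norm_num
    nlinarith
  have p1 := par x₁ x₂
  have p2 := par (x₁ - t • y₁) (x₂ - t • y₂)
  have e1 : (1 / 2 : ℝ) • ((x₁ - t • y₁) + (x₂ - t • y₂)) =
      (1 / 2 : ℝ) • (x₁ + x₂) - t • (1 / 2 : ℝ) • (y₁ + y₂) := by module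
  have e2 : (x₂ - t • y₂) - (x₁ - t • y₁) = (x₂ - x₁) - t • (y₂ - y₁) := by module
  rw [e1, e2] at p2
  set a := x₂ - x₁
  set b := y₂ - y₁
  have key : α * ‖a‖ ^ 2 ≤ ‖a - t • b‖ ^ 2 / v + κ * ‖b‖ ^ 2 := by
    -- Completed square; it vanishes at the minimiser `b = t a / (t² + κ v)`.
    have h1 : ‖t • a - (t ^ 2 + κ * v) • b‖ ^ 2 =
        (t ^ 2 + κ * v) * (‖a - t • b‖ ^ 2 + κ * v * ‖b‖ ^ 2) - κ * v * ‖a‖ ^ 2 := by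
      rw [norm_sub_sq_real, norm_sub_sq_real]
      simp only [norm_smul, inner_smul_left, inner_smul_right, mul_pow, Real.norm_eq_abs, sq_abs,
        conj_trivial]
      ring
    have h2 : 0 ≤ ‖t • a - (t ^ 2 + κ * v) • b‖ ^ 2 := by positivity
    have h3 : ‖a - t • b‖ ^ 2 / v + κ * ‖b‖ ^ 2 = (‖a - t • b‖ ^ 2 + κ * v * ‖b‖ ^ 2) / v := by
      field_simp
    rw [h3, hα, div_mul_eq_mul_div, div_le_div_iff₀ hden hv]
    nlinarith
  have e3 : ∀ r : ℝ, -r / (2 * v) = -(r / v) / 2 := fun r => by field_simp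
  simp only [e3]
  have p3 : ‖x₁ - t • y₁‖ ^ 2 / v + ‖x₂ - t • y₂‖ ^ 2 / v =
      2 * (‖(1 / 2 : ℝ) • (x₁ + x₂) - t • (1 / 2 : ℝ) • (y₁ + y₂)‖ ^ 2 / v) +
        ‖a - t • b‖ ^ 2 / v / 2 := by
    rw [← add_div, p2]; ring
  have p4 : α * ‖x₁‖ ^ 2 + α * ‖x₂‖ ^ 2 =
      2 * (α * ‖(1 / 2 : ℝ) • (x₁ + x₂)‖ ^ 2) + α * ‖a‖ ^ 2 / 2 := by
    rw [← mul_add, p1]; ring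
  linarith

/-- Prékopa–Leindler in the integrated variable `y`, with `x₁`, `x₂` and their midpoint as
parameters. Its hypothesis is the exponent inequality inside the support and is trivial outside,
where a factor on the left vanishes. -/
lemma IsSemiLogConcave.gaussMixture_midpoint {ν : Measure (E d)} [IsProbabilityMeasure ν]
    {U : E d → ℝ} {κ : ℝ} (h : IsSemiLogConcave ν U κ) {v t : ℝ} (hv : 0 < v)
    (hden : 0 < t ^ 2 + κ * v) (x₁ x₂ : E d) :
    (Real.exp (κ / (t ^ 2 + κ * v) * ‖x₁‖ ^ 2 / 2) * gaussMixture v t ν x₁) *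
      (Real.exp (κ / (t ^ 2 + κ * v) * ‖x₂‖ ^ 2 / 2) * gaussMixture v t ν x₂) ≤
    (Real.exp (κ / (t ^ 2 + κ * v) * ‖(1 / 2 : ℝ) • (x₁ + x₂)‖ ^ 2 / 2) *
      gaussMixture v t ν ((1 / 2 : ℝ) • (x₁ + x₂))) ^ 2 := by
  set α := κ / (t ^ 2 + κ * v) with hα
  set F : E d → E d → ℝ≥0∞ := fun x y => ENNReal.ofReal (Real.exp (α * ‖x‖ ^ 2 / 2)) *
    (interior ν.support).indicator
      (fun y => ENNReal.ofReal (Real.exp (-U y) * gaussKernel v (x - t • y))) y with hF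
  have hFm : ∀ x, Measurable (F x) := fun x =>
    (h.1.measurable_indicator v t x).const_mul _
  have hFi : ∀ x, ∫⁻ y, F x y =
      ENNReal.ofReal (Real.exp (α * ‖x‖ ^ 2 / 2) * gaussMixture v t ν x) := fun x => by
    rw [ENNReal.ofReal_mul (Real.exp_pos _).le, h.1.ofReal_gaussMixture hv,
      lintegral_const_mul' _ _ (by simp)]
  have hpos : ∀ x, 0 < Real.exp (α * ‖x‖ ^ 2 / 2) * gaussMixture v t ν x := fun x =>
    mul_pos (Real.exp_pos _) (gaussMixture_pos hv x)
  have hPL := prekopaLeindler_euclidean d (F x₁) (F x₂) (F ((1 / 2 : ℝ) • (x₁ + x₂)))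
    (hFm _) (hFm _) (hFm _) ?_
  · rw [hFi, hFi, hFi, ← ENNReal.ofReal_mul (hpos _).le, ← ENNReal.ofReal_pow (hpos _).le] at hPL
    exact (ENNReal.ofReal_le_ofReal_iff (by have := hpos ((1 / 2 : ℝ) • (x₁ + x₂)); positivity)).1
      hPL
  · intro y₁ y₂
    by_cases h₁ : y₁ ∈ interior ν.support
    swap
    · simp [hF, h₁]
    by_cases h₂ : y₂ ∈ interior ν.support
    swap
    · simp [hF, h₂]
    have hm : (1 / 2 : ℝ) • (y₁ + y₂) ∈ interior ν.support := by
      rw [smul_add]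
      exact h.1.convex_support.interior h₁ h₂ (by norm_num) (by norm_num) (by norm_num)
    have hval : ∀ x y, y ∈ interior ν.support → F x y = ENNReal.ofReal
        (Real.exp (α * ‖x‖ ^ 2 / 2 + (-U y + -‖x - t • y‖ ^ 2 / (2 * v)))) := by
      intro x y hy
      simp only [hF, Set.indicator_of_mem hy, gaussKernel]
      rw [← ENNReal.ofReal_mul (Real.exp_pos _).le, ← Real.exp_add, ← Real.exp_add]
    rw [hval _ _ h₁, hval _ _ h₂, hval _ _ hm, ← ENNReal.ofReal_mul (Real.exp_pos _).le,
      ← ENNReal.ofReal_pow (Real.exp_pos _).le, ← Real.exp_add, ← Real.exp_nat_mul]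
    refine ENNReal.ofReal_le_ofReal (Real.exp_le_exp.2 ?_)
    exact gaussian_exponent_midpoint_le hv hden x₁ x₂ y₁ y₂
      (midpoint_le_of_hessian_ge isOpen_interior h.1.convex_support.interior h.1.contDiffOn h.2
        h₁ h₂)

/-- The Hessian bound for the logarithm of a Gaussian mixture of a semi-log-concave measure. -/
lemma IsSemiLogConcave.logGaussMixtureFDeriv₂_le {ν : Measure (E d)} [IsProbabilityMeasure ν]
    {U : E d → ℝ} {κ : ℝ} (h : IsSemiLogConcave ν U κ) {v t : ℝ} (hv : 0 < v)
    (hden : 0 < t ^ 2 + κ * v) (x w : E d) :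
    logGaussMixtureFDeriv₂ v t ν x w w ≤ -(κ / (t ^ 2 + κ * v)) * ‖w‖ ^ 2 := by
  set α := κ / (t ^ 2 + κ * v) with hα
  refine hessian_le_of_midpoint (hasFDerivAt_log_gaussMixture hv)
    (hasFDerivAt_fderiv_log_gaussMixture hv x) fun r => ?_
  have hQ := fun x => gaussMixture_pos (t := t) (ρ := ν) hv x
  have key := Real.log_le_log (mul_pos (mul_pos (Real.exp_pos _) (hQ (x + r • w)))
    (mul_pos (Real.exp_pos _) (hQ (x - r • w)))) (h.gaussMixture_midpoint hv hden _ _)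
  have hlog : ∀ (a : ℝ) (z : E d), Real.log (Real.exp a * gaussMixture v t ν z) =
      a + Real.log (gaussMixture v t ν z) := fun a z => by
    rw [Real.log_mul (Real.exp_pos _).ne' (hQ z).ne', Real.log_exp]
  have hmid : (1 / 2 : ℝ) • (x + r • w + (x - r • w)) = x := by module
  rw [Real.log_mul (mul_pos (Real.exp_pos _) (hQ _)).ne' (mul_pos (Real.exp_pos _) (hQ _)).ne',
    Real.log_pow, hlog, hlog, hlog, hmid, ← hα] at key
  -- The quadratic correction contributes exactly `α r² ‖w‖²`, which becomes the Hessian bound.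
  have p := parallelogram_law_with_norm ℝ x (r • w)
  have e : ‖r • w‖ ^ 2 = r ^ 2 * ‖w‖ ^ 2 := by
    rw [norm_smul, mul_pow, Real.norm_eq_abs, sq_abs]
  have p' : α * ‖x + r • w‖ ^ 2 + α * ‖x - r • w‖ ^ 2 =
      2 * (α * ‖x‖ ^ 2) + 2 * (α * (r ^ 2 * ‖w‖ ^ 2)) := by
    rw [← e, ← mul_add, p]; ring
  push_cast at key
  nlinarith

/-! ### Jacobian bounds for the velocity field -/

lemma gaussianDensity_eq (m : E d) (v : ℝ) (x : E d) :
    gaussianDensity m v x = (√(2 * Real.pi * v))⁻¹ ^ d * gaussKernel v (x - m) := rfl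

lemma HasPotential.marginalDensity_eq {ν : Measure (E d)} {U : E d → ℝ} (h : HasPotential ν U)
    (s : ℝ) {t : ℝ} (ht : t ≠ 1) (x : E d) :
    marginalDensity s (density ν U) t x =
      (√(2 * Real.pi * ((1 - t ^ 2) * s ^ 2)))⁻¹ ^ d *
        gaussMixture ((1 - t ^ 2) * s ^ 2) t ν x := by
  rw [marginalDensity, if_neg ht, gaussMixture, ← integral_const_mul]
  conv_rhs => rw [h.eq_withDensity]
  rw [integral_withDensity_eq_integral_toReal_smul₀ h.aemeasurable_density.ennreal_ofReal
    (.of_forall fun _ => ENNReal.ofReal_lt_top)]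
  congr 1 with y
  have : 0 ≤ density ν U y := Set.indicator_nonneg (fun _ _ => (Real.exp_pos _).le) y
  rw [ENNReal.toReal_ofReal this, smul_eq_mul, gaussianDensity_eq]
  ring

/-- The constant `K` becomes additive under the logarithm and disappears in the gradient. The mixing
measure `ρ` need not be `ν`, which is what the convolution case exploits. -/
lemma jacobianLE_velocity_of_mixture {ν ρ : Measure (E d)} [IsProbabilityMeasure ρ]
    {U : E d → ℝ} {s t v K c : ℝ} (ht : 0 < t) (hv : 0 < v) (hK : 0 < K)
    (hq : ∀ x, marginalDensity s (density ν U) t x = K * gaussMixture v t ρ x) {x : E d}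
    (hc : ∀ w, logGaussMixtureFDeriv₂ v t ρ x w w ≤ c * ‖w‖ ^ 2) :
    JacobianLE (velocity s ν U t) x (t⁻¹ * (1 + s ^ 2 * c)) := by
  have hlog : (fun z => Real.log (marginalDensity s (density ν U) t z)) =
      fun z => Real.log K + Real.log (gaussMixture v t ρ z) := by
    ext z
    rw [hq, Real.log_mul hK.ne' (gaussMixture_pos hv z).ne']
  have hvel : velocity s ν U t = fun y => t⁻¹ • (y + s ^ 2 • gradient
      (fun z => Real.log K + Real.log (gaussMixture v t ρ z)) y) := by
    ext1 y
    simp only [velocity, if_neg ht.ne', score, hlog]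
  rw [hvel]
  exact jacobianLE_gradient_field ht (sq_nonneg s)
    (.of_forall fun y => (hasFDerivAt_log_gaussMixture hv y).const_add _)
    (hasFDerivAt_fderiv_log_gaussMixture hv x) hc

lemma jacobianLE_velocity_zero (s : ℝ) (ν : Measure (E d)) (U : E d → ℝ) (x : E d) :
    JacobianLE (velocity s ν U 0) x 0 := by
  have : velocity s ν U 0 = fun _ => ∫ y, y ∂ν := by
    ext1 x; simp [velocity]
  rw [this]
  exact jacobianLE_const _ _

/-! ### Gaussian convolutions -/

section Convolution

lemma integral_rexp_quadratic {b : ℝ} (hb : 0 < b) (c : ℝ) (w : E d) :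
    ∫ v : E d, Real.exp (-b * ‖v‖ ^ 2 + c * inner ℝ w v) =
      (Real.pi / b) ^ (d / 2 : ℝ) * Real.exp (c ^ 2 * ‖w‖ ^ 2 / (4 * b)) := by
  have h := GaussianFourier.integral_cexp_neg_mul_sq_norm_add (b := (b : ℂ)) (by simpa using hb)
    (c : ℂ) w
  rw [finrank_euclideanSpace_fin] at h
  have h2 : ∫ v : E d, Complex.exp (-b * ‖v‖ ^ 2 + c * (inner ℝ w v : ℝ)) =
      ((∫ v : E d, Real.exp (-b * ‖v‖ ^ 2 + c * inner ℝ w v) : ℝ) : ℂ) := by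
    rw [← integral_complex_ofReal]
    congr 1 with v
    push_cast
    rfl
  rw [h2] at h
  rw [← Complex.ofReal_inj, h]
  push_cast
  rw [Complex.ofReal_cpow (by positivity)]
  push_cast
  rfl

/-- A non-integrable function has integral zero by convention, whereas the closed formula gives a
positive value. -/
lemma integrable_gaussKernel_volume {v : ℝ} (hv : 0 < v) :
    Integrable (gaussKernel v : E d → ℝ) := by
  by_contra h
  have h1 := integral_rexp_quadratic (d := d) (b := (2 * v)⁻¹) (by positivity) 0 0
  have e : (fun u : E d => Real.exp (-(2 * v)⁻¹ * ‖u‖ ^ 2 + 0 * inner ℝ 0 u)) = gaussKernel v := by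
    ext u
    simp only [gaussKernel]
    congr 1
    rw [zero_mul]
    ring
  rw [e, integral_undef h] at h1
  have : 0 < (Real.pi / (2 * v)⁻¹) ^ (d / 2 : ℝ) *
    Real.exp (0 ^ 2 * ‖(0 : E d)‖ ^ 2 / (4 * (2 * v)⁻¹)) := by positivity
  exact this.ne h1

/-- The isotropic Gaussian measure has a Gaussian density. -/
lemma exists_multivariateGaussian_eq_withDensity {σ : ℝ} (hσ : 0 < σ) :
    ∃ K : ℝ, 0 < K ∧ multivariateGaussian (0 : E d) ((σ ^ 2) • (1 : Matrix (Fin d) (Fin d) ℝ)) =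
      volume.withDensity fun x => ENNReal.ofReal (K * gaussKernel (σ ^ 2) x) := by
  have hσ2 : 0 < σ ^ 2 := by positivity
  set b : ℝ := (2 * σ ^ 2)⁻¹ with hb
  have hb0 : 0 < b := by positivity
  have hker : ∀ u : E d, gaussKernel (σ ^ 2) u = Real.exp (-b * ‖u‖ ^ 2) := fun u => by
    simp only [gaussKernel, hb]; congr 1; ring
  set K₀ : ℝ := (Real.pi / b) ^ (d / 2 : ℝ) with hK₀
  have hK₀pos : 0 < K₀ := by positivity
  have hint : ∫ u : E d, gaussKernel (σ ^ 2) u = K₀ := by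
    simpa [hker] using integral_rexp_quadratic (d := d) hb0 0 0
  have hi := integrable_gaussKernel_volume (d := d) hσ2
  have hmeas : Measurable fun x : E d => K₀⁻¹ * gaussKernel (σ ^ 2) x :=
    Continuous.measurable (by fun_prop)
  have hnn : ∀ x : E d, 0 ≤ K₀⁻¹ * gaussKernel (σ ^ 2) x := fun x => by
    have := gaussKernel_pos (σ ^ 2) x; positivity
  refine ⟨K₀⁻¹, by positivity, ?_⟩
  have hfin : IsFiniteMeasure (volume.withDensity fun x : E d =>
      ENNReal.ofReal (K₀⁻¹ * gaussKernel (σ ^ 2) x)) :=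
    isFiniteMeasure_withDensity_ofReal (hi.const_mul _).2
  -- Both measures are finite, so it suffices to match characteristic functions; for the density
  -- this is the Gaussian integral with linear coefficient `i`.
  refine Measure.ext_of_charFun ?_
  ext w
  have hpsd : ((σ ^ 2) • (1 : Matrix (Fin d) (Fin d) ℝ)).PosSemidef :=
    Matrix.PosSemidef.one.smul hσ2.le
  rw [charFun_multivariateGaussian hpsd, charFun_apply,
    integral_withDensity_eq_integral_toReal_smul hmeas.ennreal_ofReal
      (.of_forall fun _ => ENNReal.ofReal_lt_top)]
  have hF := GaussianFourier.integral_cexp_neg_mul_sq_norm_add (b := (b : ℂ)) (by simpa using hb0)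
    Complex.I w
  rw [finrank_euclideanSpace_fin] at hF
  have e : ∀ u : E d, (ENNReal.ofReal (K₀⁻¹ * gaussKernel (σ ^ 2) u)).toReal •
      Complex.exp ((inner ℝ u w : ℝ) * Complex.I) =
      ((K₀⁻¹ : ℝ) : ℂ) * Complex.exp (-b * ‖u‖ ^ 2 + Complex.I * (inner ℝ w u : ℝ)) := by
    intro u
    rw [ENNReal.toReal_ofReal (hnn u), hker, Complex.real_smul, Complex.exp_add, real_inner_comm]
    push_cast
    ring_nf
  simp_rw [e]
  have hK₀c : ((K₀ : ℝ) : ℂ) = (Real.pi / b : ℂ) ^ (d / 2 : ℂ) := by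
    rw [hK₀, Complex.ofReal_cpow (by positivity)]
    push_cast
    rfl
  rw [integral_const_mul, hF, ← hK₀c, ← mul_assoc, ← Complex.ofReal_mul,
    inv_mul_cancel₀ hK₀pos.ne', Complex.ofReal_one, one_mul, inner_zero_right]
  congr 1
  have e2 : (w : Fin d → ℝ) ⬝ᵥ ((σ ^ 2) • (1 : Matrix (Fin d) (Fin d) ℝ)).mulVec w =
      σ ^ 2 * ‖w‖ ^ 2 := by
    rw [Matrix.smul_mulVec, Matrix.one_mulVec, dotProduct_smul, EuclideanSpace.real_norm_sq_eq]
    simp [dotProduct, sq]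
  rw [e2, hb]
  push_cast
  have : (σ : ℂ) ≠ 0 := by exact_mod_cast hσ.ne'
  rw [Complex.I_sq]
  field_simp
  ring

/-- Smoothing a Gaussian kernel by an isotropic Gaussian measure. -/
lemma exists_integral_gaussKernel_multivariateGaussian {σ v : ℝ} (hσ : 0 < σ) (hv : 0 < v)
    (t : ℝ) : ∃ K : ℝ, 0 < K ∧ ∀ u : E d,
      ∫ w, gaussKernel v (u - t • w)
        ∂(multivariateGaussian (0 : E d) ((σ ^ 2) • (1 : Matrix (Fin d) (Fin d) ℝ))) =
      K * gaussKernel (v + t ^ 2 * σ ^ 2) u := by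
  obtain ⟨K, hK, hN⟩ := exists_multivariateGaussian_eq_withDensity (d := d) hσ
  -- Coefficient of `-‖w‖²` in the sum of the two Gaussian exponents.
  set b : ℝ := (2 * σ ^ 2)⁻¹ + t ^ 2 * (2 * v)⁻¹ with hb
  have hb0 : 0 < b := by positivity
  refine ⟨K * (Real.pi / b) ^ (d / 2 : ℝ), by positivity, fun u => ?_⟩
  have hmeas : Measurable fun x : E d => K * gaussKernel (σ ^ 2) x :=
    Continuous.measurable (by fun_prop)
  rw [hN, integral_withDensity_eq_integral_toReal_smul hmeas.ennreal_ofReal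
    (.of_forall fun _ => ENNReal.ofReal_lt_top)]
  have e : ∀ w : E d, (ENNReal.ofReal (K * gaussKernel (σ ^ 2) w)).toReal •
      gaussKernel v (u - t • w) = (K * Real.exp (-‖u‖ ^ 2 / (2 * v))) *
        Real.exp (-b * ‖w‖ ^ 2 + t / v * inner ℝ u w) := by
    intro w
    have := gaussKernel_pos (σ ^ 2) w
    rw [ENNReal.toReal_ofReal (by positivity), smul_eq_mul, gaussKernel, gaussKernel, mul_assoc,
      mul_assoc, ← Real.exp_add, ← Real.exp_add, norm_sub_sq_real, norm_smul, inner_smul_right,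
      mul_pow, Real.norm_eq_abs, sq_abs, hb]
    congr 2
    field_simp
    ring
  simp_rw [e]
  rw [integral_const_mul, integral_rexp_quadratic hb0]
  rw [gaussKernel, mul_assoc, mul_assoc, mul_left_comm (Real.exp _), ← Real.exp_add]
  congr 3
  have hb' : b = (v + t ^ 2 * σ ^ 2) / (2 * σ ^ 2 * v) := by
    rw [hb]; field_simp
  rw [hb']
  field_simp
  ring

variable {ν ρ : Measure (E d)} [IsProbabilityMeasure ρ] {σ : ℝ}

/-- Writing a point of `ν` as `z + w` with `w` Gaussian, the integral over `w` smooths the kernel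
and adds the variance `t² σ²` of `t w`. -/
lemma exists_gaussMixture_conv (hσ : 0 < σ)
    (hν : ν = (multivariateGaussian 0 ((σ ^ 2) • (1 : Matrix (Fin d) (Fin d) ℝ))).conv ρ)
    {v : ℝ} (hv : 0 < v) (t : ℝ) : ∃ K : ℝ, 0 < K ∧ ∀ x,
      gaussMixture v t ν x = K * gaussMixture (v + t ^ 2 * σ ^ 2) t ρ x := by
  obtain ⟨K, hK, hKu⟩ := exists_integral_gaussKernel_multivariateGaussian (d := d) hσ hv t
  refine ⟨K, hK, fun x => ?_⟩
  rw [gaussMixture, hν, Measure.conv_comm, integral_conv (integrable_gaussKernel hv x),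
    gaussMixture, ← integral_const_mul]
  congr 1 with z
  rw [← hKu]
  congr 1 with w
  rw [smul_add, sub_sub]

lemma exists_conv_eq_withDensity (hσ : 0 < σ)
    (hν : ν = (multivariateGaussian 0 ((σ ^ 2) • (1 : Matrix (Fin d) (Fin d) ℝ))).conv ρ) :
    ∃ K : ℝ, 0 < K ∧
      ν = volume.withDensity fun x => ENNReal.ofReal (K * gaussMixture (σ ^ 2) 1 ρ x) := by
  obtain ⟨K, hK, hN⟩ := exists_multivariateGaussian_eq_withDensity (d := d) hσ
  have hσ2 : 0 < σ ^ 2 := by positivity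
  refine ⟨K, hK, ?_⟩
  have hmeas : Measurable fun x : E d => ENNReal.ofReal (K * gaussKernel (σ ^ 2) x) :=
    (Continuous.measurable (by fun_prop)).ennreal_ofReal
  have hmix : ∀ x, ENNReal.ofReal (K * gaussMixture (σ ^ 2) 1 ρ x) =
      ∫⁻ z, ENNReal.ofReal (K * gaussKernel (σ ^ 2) (x - z)) ∂ρ := by
    intro x
    have hi := (integrable_gaussKernel (t := 1) (ρ := ρ) hσ2 x).const_mul K
    rw [gaussMixture, ← integral_const_mul, ofReal_integral_eq_lintegral_ofReal hi]
    · simp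
    · exact .of_forall fun y => (mul_pos hK (gaussKernel_pos _ _)).le
  simp_rw [hmix]
  have hmeas2 : Measurable fun p : E d × E d =>
      ENNReal.ofReal (K * gaussKernel (σ ^ 2) (p.1 - p.2)) := hmeas.comp measurable_sub
  refine Measure.ext_of_lintegral _ fun f hf => ?_
  rw [lintegral_withDensity_eq_lintegral_mul _ hmeas2.lintegral_prod_right' hf, hν,
    Measure.conv_comm, Measure.lintegral_conv hf, hN]
  calc ∫⁻ z, ∫⁻ w, f (z + w) ∂(volume.withDensity
        fun x => ENNReal.ofReal (K * gaussKernel (σ ^ 2) x)) ∂ρ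
      = ∫⁻ z, (∫⁻ x, ENNReal.ofReal (K * gaussKernel (σ ^ 2) (x - z)) * f x) ∂ρ := by
        refine lintegral_congr fun z => ?_
        -- Translation invariance of Lebesgue measure moves the shift by `z` from `f` onto the
        -- kernel.
        rw [lintegral_withDensity_eq_lintegral_mul _ hmeas (by fun_prop),
          ← lintegral_add_left_eq_self (fun x => _ * f x) z]
        simp
    _ = ∫⁻ x, ∫⁻ z, ENNReal.ofReal (K * gaussKernel (σ ^ 2) (x - z)) * f x ∂ρ := by
        rw [lintegral_lintegral_swap]
        exact ((hmeas2.comp measurable_swap).mul (hf.comp measurable_snd)).aemeasurable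
    _ = _ := by
        refine lintegral_congr fun x => ?_
        rw [lintegral_mul_const]
        · rfl
        · exact (Continuous.measurable (by fun_prop)).ennreal_ofReal

/-- At `t = 1` the marginal is the density itself, so a pointwise identity is needed. The
convolution charges every open set, so the support is the whole space and `U` is continuous; two
continuous functions that agree almost everywhere are equal. -/
lemma exists_density_conv (hσ : 0 < σ)
    (hν : ν = (multivariateGaussian 0 ((σ ^ 2) • (1 : Matrix (Fin d) (Fin d) ℝ))).conv ρ)
    {U : E d → ℝ} (hU : HasPotential ν U) :
    ∃ K : ℝ, 0 < K ∧ ∀ x, density ν U x = K * gaussMixture (σ ^ 2) 1 ρ x := by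
  obtain ⟨K, hK, hd⟩ := exists_conv_eq_withDensity hσ hν
  have hσ2 : 0 < σ ^ 2 := by positivity
  have hcont : Continuous (gaussMixture (σ ^ 2) 1 ρ) :=
    continuous_iff_continuousAt.2 fun x => (hasFDerivAt_gaussMixture hσ2 x).continuousAt
  have hpos : ∀ x, 0 < K * gaussMixture (σ ^ 2) 1 ρ x := fun x =>
    mul_pos hK (gaussMixture_pos hσ2 x)
  have hmeas : Measurable fun x => ENNReal.ofReal (K * gaussMixture (σ ^ 2) 1 ρ x) :=
    (Continuous.measurable (by fun_prop)).ennreal_ofReal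
  have hac : (volume : Measure (E d)) ≪ ν := by
    rw [hd]
    exact withDensity_absolutelyContinuous' hmeas.aemeasurable
      (.of_forall fun x => by simpa using hpos x)
  have : ν.IsOpenPosMeasure := hac.isOpenPosMeasure
  have hsupp : ν.support = Set.univ := Measure.support_eq_univ
  have hUc : Continuous U := by
    have := hU.contDiffOn.continuousOn
    rwa [hsupp, interior_univ, continuousOn_univ] at this
  have hdens : density ν U = fun x => Real.exp (-U x) := by
    ext x; simp [density, hsupp]
  have hae := (withDensity_eq_iff_of_sigmaFinite hU.aemeasurable_density.ennreal_ofReal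
    hmeas.aemeasurable).1 (hU.eq_withDensity.symm.trans hd)
  rw [hdens] at hae ⊢
  refine ⟨K, hK, fun x => ?_⟩
  have heq : (fun x => Real.exp (-U x)) = fun x => K * gaussMixture (σ ^ 2) 1 ρ x := by
    refine (Continuous.ae_eq_iff_eq volume (by fun_prop) (by fun_prop)).1 ?_
    filter_upwards [hae] with x hx
    exact (ENNReal.ofReal_eq_ofReal_iff (Real.exp_pos _).le (hpos x).le).1 hx
  exact congrFun heq x

end Convolution

/-- The Jacobian bound in the Gaussian convolution case. -/
lemma GaussianConvCase.jacobianLE {ν : Measure (E d)} [IsProbabilityMeasure ν] {U : E d → ℝ}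
    (hU : HasPotential ν U) {s σ R : ℝ} (hs : 0 < s) (hσ : 0 < σ) (h : GaussianConvCase ν σ R)
    {t : ℝ} (ht : t ∈ Set.Icc (0 : ℝ) 1) (x : E d) :
    JacobianLE (velocity s ν U t) x (convBound s σ R t) := by
  obtain ⟨ρ, c, hρ, hsupp, hν⟩ := h
  rcases ht.1.eq_or_lt with rfl | ht0
  · simpa [convBound] using jacobianLE_velocity_zero s ν U x
  -- This is `(1 - t²) s² + t² σ²`, the kernel variance after absorbing the Gaussian factor; it
  -- stays positive at `t = 1`.
  set v : ℝ := s ^ 2 + (σ ^ 2 - s ^ 2) * t ^ 2 with hvdef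
  have ht2 : t ^ 2 ≤ 1 := pow_le_one₀ ht0.le ht.2
  have hv : 0 < v := by
    have h1 : v = s ^ 2 * (1 - t ^ 2) + σ ^ 2 * t ^ 2 := by rw [hvdef]; ring
    have h2 : 0 ≤ s ^ 2 * (1 - t ^ 2) := mul_nonneg (by positivity) (by linarith)
    have h3 : 0 < σ ^ 2 * t ^ 2 := by positivity
    linarith
  obtain ⟨K, hK, hq⟩ : ∃ K : ℝ, 0 < K ∧ ∀ x,
      marginalDensity s (density ν U) t x = K * gaussMixture v t ρ x := by
    rcases ht.2.eq_or_lt with rfl | ht1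
    · obtain ⟨K, hK, h⟩ := exists_density_conv hσ hν hU
      refine ⟨K, hK, fun x => ?_⟩
      have : v = σ ^ 2 := by rw [hvdef]; ring
      rw [marginalDensity, if_pos rfl, h, this]
    · have hv₀ : 0 < (1 - t ^ 2) * s ^ 2 := by
        have : t ^ 2 < 1 := pow_lt_one₀ ht0.le ht1 (by norm_num)
        exact mul_pos (by linarith) (by positivity)
      obtain ⟨K, hK, h⟩ := exists_gaussMixture_conv hσ hν hv₀ t
      refine ⟨(√(2 * Real.pi * ((1 - t ^ 2) * s ^ 2)))⁻¹ ^ d * K, by positivity, fun x => ?_⟩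
      have : v = (1 - t ^ 2) * s ^ 2 + t ^ 2 * σ ^ 2 := by rw [hvdef]; ring
      rw [hU.marginalDensity_eq s ht1.ne, h, this, ← mul_assoc]
  have hball : ∀ᵐ y ∂ρ, y ∈ Metric.closedBall c R := hsupp
  have hosc : ∀ w, logGaussMixtureFDeriv₂ v t ρ x w w ≤
      (t ^ 2 * R ^ 2 / v ^ 2 - 1 / v) * ‖w‖ ^ 2 := by
    intro w
    have := logGaussMixtureFDeriv₂_le (t := t) (ρ := ρ) hv x w (m := inner ℝ c w)
      (r := R * ‖w‖) (by
        filter_upwards [hball] with y hy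
        rw [← inner_sub_left]
        refine (abs_real_inner_le_norm _ _).trans ?_
        gcongr
        simpa [dist_eq_norm] using hy)
    refine this.trans (le_of_eq ?_)
    ring
  convert jacobianLE_velocity_of_mixture ht0 hv hK hq hosc using 1
  rw [convBound, ← hvdef]
  field_simp
  rw [hvdef]
  ring

lemma one_sub_sq_pos {t : ℝ} (ht : t ∈ Set.Ico (0 : ℝ) 1) : 0 < 1 - t ^ 2 := by
  have : t ^ 2 < 1 := pow_lt_one₀ ht.1 ht.2 (by norm_num)
  linarith

/-! ### The diameter bound -/

lemma scaledDiam_toReal_sq (ν : Measure (E d)) :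
    (scaledDiam ν).toReal ^ 2 = Metric.diam ν.support ^ 2 / 2 := by
  rw [scaledDiam, ENNReal.toReal_mul, ENNReal.toReal_ofReal (by positivity), mul_pow, div_pow,
    Real.sq_sqrt (by norm_num), Metric.diam]
  ring

lemma isBounded_support_of_scaledDiam {ν : Measure (E d)} (h : scaledDiam ν ≠ ⊤) :
    Bornology.IsBounded ν.support := by
  rw [Metric.isBounded_iff_ediam_ne_top]
  intro htop
  exact h (by rw [scaledDiam, htop, ENNReal.mul_top (by simp)])

/-- The centre `m` is the midpoint of the range of the linear form, whose length is at most `diam S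
* ‖w‖`. -/
lemma exists_abs_inner_sub_le {S : Set (E d)} (hS : Bornology.IsBounded S) (w : E d) :
    ∃ m : ℝ, ∀ y ∈ S, |inner ℝ y w - m| ≤ Metric.diam S * ‖w‖ / 2 := by
  set A := (fun y => inner ℝ y w) '' S
  have hlip : LipschitzWith ‖w‖₊ fun y : E d => inner ℝ y w :=
    LipschitzWith.of_dist_le_mul fun y z => by
      rw [Real.dist_eq, ← inner_sub_left, mul_comm, dist_eq_norm]
      exact abs_real_inner_le_norm _ _
  have hA : Bornology.IsBounded A := hlip.isBounded_image hS
  have hdiam : Metric.diam A ≤ ‖w‖ * Metric.diam S := hlip.diam_image_le S hS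
  rw [Real.diam_eq hA] at hdiam
  refine ⟨(sSup A + sInf A) / 2, fun y hy => ?_⟩
  have h1 := le_csSup hA.bddAbove (Set.mem_image_of_mem (fun y => inner ℝ y w) hy)
  have h2 := csInf_le hA.bddBelow (Set.mem_image_of_mem (fun y => inner ℝ y w) hy)
  rw [abs_le]
  constructor <;> linarith

lemma HasPotential.jacobianLE_diamBound {ν : Measure (E d)} [IsProbabilityMeasure ν] {U : E d → ℝ}
    (hU : HasPotential ν U) (hD : scaledDiam ν ≠ ⊤) {s : ℝ} (hs : 0 < s) {t : ℝ}
    (ht : t ∈ Set.Ico (0 : ℝ) 1) (x : E d) :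
    JacobianLE (velocity s ν U t) x (diamBound s (scaledDiam ν).toReal t) := by
  rcases ht.1.eq_or_lt with rfl | ht0
  · simpa [diamBound] using jacobianLE_velocity_zero s ν U x
  have ht1 := one_sub_sq_pos ht
  have hv : 0 < (1 - t ^ 2) * s ^ 2 := by positivity
  set D := (scaledDiam ν).toReal
  have hosc : ∀ w, logGaussMixtureFDeriv₂ ((1 - t ^ 2) * s ^ 2) t ν x w w ≤
      (t ^ 2 * D ^ 2 / ((1 - t ^ 2) * s ^ 2) ^ 2 - 1 / ((1 - t ^ 2) * s ^ 2)) * ‖w‖ ^ 2 := by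
    intro w
    obtain ⟨m, hm⟩ := exists_abs_inner_sub_le (isBounded_support_of_scaledDiam hD) w
    refine (Follmer.logGaussMixtureFDeriv₂_le (t := t) (ρ := ν) hv x w (m := m)
      (r := Metric.diam ν.support * ‖w‖ / 2)
      (Filter.mem_of_superset Measure.support_mem_ae hm)).trans ?_
    -- The left side is `D² ‖w‖² / 2`, so a factor of two is given away here.
    have h1 : (Metric.diam ν.support * ‖w‖ / 2) ^ 2 ≤ D ^ 2 * ‖w‖ ^ 2 := by
      rw [scaledDiam_toReal_sq]
      nlinarith [sq_nonneg (Metric.diam ν.support * ‖w‖)]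
    have h2 : t ^ 2 * (Metric.diam ν.support * ‖w‖ / 2) ^ 2 / ((1 - t ^ 2) * s ^ 2) ^ 2 ≤
        t ^ 2 * (D ^ 2 * ‖w‖ ^ 2) / ((1 - t ^ 2) * s ^ 2) ^ 2 := by gcongr
    refine (sub_le_sub_right h2 _).trans (le_of_eq ?_)
    ring
  convert jacobianLE_velocity_of_mixture ht0 hv (by positivity)
    (hU.marginalDensity_eq s ht.2.ne) hosc using 1
  rw [diamBound]
  field_simp
  ring

/-! ### The semi-log-concavity bound -/

/-- Near an interior point of the support `ln q_1 = -U`, so the Hessian bound on `U` is used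
directly, without a mixture. -/
lemma IsSemiLogConcave.jacobianLE_velocity_one {ν : Measure (E d)} {U : E d → ℝ} {κ : ℝ}
    (h : IsSemiLogConcave ν U κ) (s : ℝ) {x : E d} (hx : x ∈ interior ν.support) :
    JacobianLE (velocity s ν U 1) x (1 - κ * s ^ 2) := by
  set L : E d → ℝ := fun z => Real.log (marginalDensity s (density ν U) 1 z) with hL
  have hLU : ∀ y ∈ interior ν.support, L =ᶠ[nhds y] fun z => -U z := fun y hy => by
    filter_upwards [isOpen_interior.mem_nhds hy] with z hz
    simp [hL, marginalDensity, density, interior_subset hz]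
  have hd : ∀ y ∈ interior ν.support, HasFDerivAt L (-fderiv ℝ U y) y := fun y hy =>
    ((h.1.contDiffOn.contDiffAt (isOpen_interior.mem_nhds hy)).differentiableAt
      (by norm_num)).hasFDerivAt.neg.congr_of_eventuallyEq (hLU y hy)
  have hd2 : HasFDerivAt (fun y => -fderiv ℝ U y) (-fderiv ℝ (fderiv ℝ U) x) x :=
    (((h.1.contDiffOn.contDiffAt (isOpen_interior.mem_nhds hx)).fderiv_right (m := 1)
      (by norm_num)).differentiableAt (by norm_num)).hasFDerivAt.neg
  have hvel : velocity s ν U 1 = fun y => (1 : ℝ)⁻¹ • (y + s ^ 2 • gradient L y) := by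
    ext1 y
    simp only [velocity, if_neg one_ne_zero, score, hL]
  rw [hvel]
  convert jacobianLE_gradient_field (c := -κ) one_pos (sq_nonneg s)
    (Filter.mem_of_superset (isOpen_interior.mem_nhds hx) hd) hd2 (fun w => ?_) using 1
  · ring
  · have := h.2 x hx w
    simp only [neg_apply]
    linarith

lemma IsSemiLogConcave.jacobianLE_kappaBound {ν : Measure (E d)} [IsProbabilityMeasure ν]
    {U : E d → ℝ} {κ : ℝ} (h : IsSemiLogConcave ν U κ) {s : ℝ} (hs : 0 < s) {t : ℝ}
    (ht : t ∈ Set.Icc (0 : ℝ) 1) (hden : 0 < kappaDenom s κ t) {x : E d}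
    (hx : t = 1 → x ∈ interior ν.support) :
    JacobianLE (velocity s ν U t) x (kappaBound s κ t) := by
  rcases ht.1.eq_or_lt with rfl | ht0
  · simpa [kappaBound] using jacobianLE_velocity_zero s ν U x
  rcases ht.2.eq_or_lt with rfl | ht1
  · simpa [kappaBound, kappaDenom] using h.jacobianLE_velocity_one s (hx rfl)
  have ht2 := one_sub_sq_pos ⟨ht.1, ht1⟩
  have hv : 0 < (1 - t ^ 2) * s ^ 2 := by positivity
  have e : t ^ 2 + κ * ((1 - t ^ 2) * s ^ 2) = kappaDenom s κ t := by
    rw [kappaDenom]; ring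
  convert jacobianLE_velocity_of_mixture ht0 hv (by positivity)
    (h.1.marginalDensity_eq s ht1.ne)
    (h.logGaussMixtureFDeriv₂_le hv (by rwa [e]) x) using 1
  rw [e, kappaBound]
  field_simp
  rw [kappaDenom]
  ring

/-- The denominator equals `t² + κ s² (1 - t²)`; for `κ < 0` it increases in `t ≥ 0`, and
`kappaStart` is where its sign changes. -/
lemma kappaDenom_nonneg {s κ t : ℝ} (ht : t ∈ Set.Icc (kappaStart s κ) 1) :
    0 ≤ kappaDenom s κ t := by
  have ht0 : 0 ≤ t := (Real.sqrt_nonneg _).trans ht.1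
  have ht1 : t ^ 2 ≤ 1 := pow_le_one₀ ht0 ht.2
  have e : kappaDenom s κ t = t ^ 2 + κ * s ^ 2 * (1 - t ^ 2) := by rw [kappaDenom]; ring
  rcases le_or_gt 0 κ with hκ | hκ
  · have : 0 ≤ κ * s ^ 2 * (1 - t ^ 2) := mul_nonneg (by positivity) (by linarith)
    rw [e]
    positivity
  · have h1 : κ * s ^ 2 ≤ 0 := mul_nonpos_of_nonpos_of_nonneg hκ.le (sq_nonneg s)
    have h2 := ht.1
    rw [kappaStart, if_pos hκ, Real.sqrt_le_left ht0, div_le_iff_of_neg (by linarith)] at h2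
    rw [e]
    linarith

lemma kappaDenom_pos {s κ t : ℝ} (hs : 0 < s) (hκ : 0 < κ) (ht : t ∈ Set.Icc (0 : ℝ) 1) :
    0 < kappaDenom s κ t := by
  have e : kappaDenom s κ t = t ^ 2 + κ * s ^ 2 * (1 - t ^ 2) := by rw [kappaDenom]; ring
  have h : 0 < κ * s ^ 2 := by positivity
  rcases ht.2.eq_or_lt with rfl | ht1
  · rw [e]; norm_num
  · have := one_sub_sq_pos ⟨ht.1, ht1⟩
    rw [e]
    positivity

/-! ### Comparison of the two bounds -/

section Comparison

variable {s κ D t : ℝ}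

/-- Exposes the factor `t / (1 - t²)` shared with `diamBound_eq`, leaving only `1 / kappaDenom` and
`D² / (s² (1 - t²))` to compare. -/
lemma kappaBound_eq (ht : t ∈ Set.Ico (0 : ℝ) 1) (hden : 0 < kappaDenom s κ t) :
    kappaBound s κ t = t / (1 - t ^ 2) * (1 / kappaDenom s κ t - 1) := by
  have := one_sub_sq_pos ht
  rw [kappaBound]
  field_simp
  rw [kappaDenom]
  ring

lemma diamBound_eq (hs : 0 < s) (ht : t ∈ Set.Ico (0 : ℝ) 1) :
    diamBound s D t = t / (1 - t ^ 2) * (D ^ 2 / (s ^ 2 * (1 - t ^ 2)) - 1) := by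
  have := one_sub_sq_pos ht
  rw [diamBound]
  field_simp

/-- The sign of this quantity orders the two bounds when the denominator is positive. -/
lemma sq_mul_kappaDenom_sub (s κ D t : ℝ) :
    D ^ 2 * kappaDenom s κ t - s ^ 2 * (1 - t ^ 2) =
      D ^ 2 * t ^ 2 - s ^ 2 * (1 - κ * D ^ 2) * (1 - t ^ 2) := by
  rw [kappaDenom]; ring

lemma kappaBound_le_diamBound (hs : 0 < s) (ht : t ∈ Set.Ico (0 : ℝ) 1)
    (hden : 0 < kappaDenom s κ t)
    (h : s ^ 2 * (1 - κ * D ^ 2) * (1 - t ^ 2) ≤ D ^ 2 * t ^ 2) :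
    kappaBound s κ t ≤ diamBound s D t := by
  have ht2 := one_sub_sq_pos ht
  have h0 := ht.1
  rw [kappaBound_eq ht hden, diamBound_eq hs ht]
  gcongr ?_ * (?_ - 1)
  rw [div_le_div_iff₀ hden (by positivity)]
  linarith [sq_mul_kappaDenom_sub s κ D t]

lemma diamBound_le_kappaBound (hs : 0 < s) (ht : t ∈ Set.Ico (0 : ℝ) 1)
    (hden : 0 < kappaDenom s κ t)
    (h : D ^ 2 * t ^ 2 ≤ s ^ 2 * (1 - κ * D ^ 2) * (1 - t ^ 2)) :
    diamBound s D t ≤ kappaBound s κ t := by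
  have ht2 := one_sub_sq_pos ht
  have h0 := ht.1
  rw [kappaBound_eq ht hden, diamBound_eq hs ht]
  gcongr ?_ * (?_ - 1)
  rw [div_le_div_iff₀ (by positivity) hden]
  linarith [sq_mul_kappaDenom_sub s κ D t]

lemma crossover_sq (hs : 0 < s) (hD : 0 < D) (hκ : κ * D ^ 2 < 1) :
    crossover s κ D ^ 2 =
      s ^ 2 * (1 - κ * D ^ 2) / (s ^ 2 * (1 - κ * D ^ 2) + D ^ 2) := by
  have : 0 < 1 - κ * D ^ 2 := by linarith
  exact Real.sq_sqrt (by positivity)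

lemma crossover_mem (hs : 0 < s) (hD : 0 < D) (hκ : κ * D ^ 2 < 1) :
    crossover s κ D ∈ Set.Ioo (0 : ℝ) 1 := by
  have : 0 < 1 - κ * D ^ 2 := by linarith
  refine ⟨Real.sqrt_pos.2 (by positivity), ?_⟩
  rw [crossover, Real.sqrt_lt' one_pos, div_lt_iff₀ (by positivity)]
  have : 0 < D ^ 2 := by positivity
  linarith

lemma crossover_eq (hs : 0 < s) (hD : 0 < D) (hκ : κ * D ^ 2 < 1) :
    s ^ 2 * ((D ^ 2)⁻¹ - κ) = crossover s κ D ^ 2 / (1 - crossover s κ D ^ 2) := by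
  have : 0 < 1 - κ * D ^ 2 := by linarith
  have h1 : 0 < s ^ 2 * (1 - κ * D ^ 2) + D ^ 2 := by positivity
  have h2 : 1 - crossover s κ D ^ 2 = D ^ 2 / (s ^ 2 * (1 - κ * D ^ 2) + D ^ 2) := by
    rw [crossover_sq hs hD hκ]
    field_simp
    ring
  rw [h2, crossover_sq hs hD hκ, div_div_div_cancel_right₀ h1.ne']
  field_simp

lemma crossover_le_iff (hs : 0 < s) (hD : 0 < D) (hκ : κ * D ^ 2 < 1) (ht : 0 ≤ t) :
    crossover s κ D ≤ t ↔ s ^ 2 * (1 - κ * D ^ 2) * (1 - t ^ 2) ≤ D ^ 2 * t ^ 2 := by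
  have : 0 < 1 - κ * D ^ 2 := by linarith
  rw [crossover, Real.sqrt_le_left ht, div_le_iff₀ (by positivity)]
  constructor <;> intro h <;> linarith

/-- Past the crossover, `D² kappaDenom ≥ s² (1 - t²)`, which is positive for `t < 1`; at `t = 1` the
denominator is one. -/
lemma kappaDenom_pos_of_crossover_le (hs : 0 < s) (hD : 0 < D) (hκ : κ * D ^ 2 < 1)
    (ht : t ∈ Set.Icc (crossover s κ D) 1) : 0 < kappaDenom s κ t := by
  have ht0 : 0 ≤ t := (Real.sqrt_nonneg _).trans ht.1
  rcases ht.2.eq_or_lt with rfl | ht1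
  · simp [kappaDenom]
  · have h1 := (crossover_le_iff hs hD hκ ht0).1 ht.1
    have h2 := one_sub_sq_pos ⟨ht0, ht1⟩
    have h3 : 0 < s ^ 2 * (1 - t ^ 2) := by positivity
    have h4 : 0 < D ^ 2 * kappaDenom s κ t := by linarith [sq_mul_kappaDenom_sub s κ D t]
    exact pos_of_mul_pos_right h4 (sq_nonneg D)

end Comparison

end Follmer

end

/-! ### Assembly of the Jacobian bounds and their comparison -/

open Follmer
theorem theoremA3 {d : ℕ} (s : ℝ) (hs : 0 < s) (ν : Measure (E d)) [IsProbabilityMeasure ν]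
    (U : E d → ℝ) (hν : MomentAC ν) (hU : ∃ β : ℝ, 0 < β ∧ IsSemiLogConvex ν U β) :
    -- the semi-log-concave cases
    (∀ κ : ℝ, LogConcaveCase ν U κ →
      -- the `D²`-based bound
      (scaledDiam ν ≠ ⊤ → ∀ t ∈ Set.Ico (0 : ℝ) 1, ∀ x : E d,
        JacobianLE (velocity s ν U t) x (diamBound s (scaledDiam ν).toReal t)) ∧
      -- the `κ`-based bound
      (∀ t ∈ Set.Icc (kappaStart s κ) 1, kappaDenom s κ t ≠ 0 →
        ∀ x : E d, (t = 1 → x ∈ interior ν.support) →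
          JacobianLE (velocity s ν U t) x (kappaBound s κ t)) ∧
      -- the case `κ D² ≥ 1`: the `κ`-based bound holds at all times and is the smaller one
      (scaledDiam ν = ⊤ ∨ 1 ≤ κ * (scaledDiam ν).toReal ^ 2 →
        (∀ t ∈ Set.Icc (0 : ℝ) 1, ∀ x : E d, (t = 1 → x ∈ interior ν.support) →
          LambdaMaxJacobianLE (velocity s ν U t) x (kappaBound s κ t)) ∧
        (scaledDiam ν ≠ ⊤ → ∀ t ∈ Set.Ico (0 : ℝ) 1,
          kappaBound s κ t ≤ diamBound s (scaledDiam ν).toReal t)) ∧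
      -- the case `κ D² < 1`: the smaller bound is the `D²`-based one before `t₀`, then the other
      (scaledDiam ν ≠ ⊤ → ∀ D : ℝ, D = (scaledDiam ν).toReal → κ * D ^ 2 < 1 →
        (∀ t ∈ Set.Icc (0 : ℝ) 1, ∀ x : E d, (t = 1 → x ∈ interior ν.support) →
          LambdaMaxJacobianLE (velocity s ν U t) x (crossoverBound s κ D t)) ∧
        crossover s κ D ∈ Set.Ioo (0 : ℝ) 1 ∧
        s ^ 2 * ((D ^ 2)⁻¹ - κ) = crossover s κ D ^ 2 / (1 - crossover s κ D ^ 2) ∧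
        (∀ t ∈ Set.Ico 0 (crossover s κ D), 0 < kappaDenom s κ t →
          diamBound s D t ≤ kappaBound s κ t) ∧
        (∀ t ∈ Set.Ico (crossover s κ D) 1,
          0 < kappaDenom s κ t ∧ kappaBound s κ t ≤ diamBound s D t))) ∧
    -- the Gaussian convolution case
    (∀ σ R : ℝ, 0 < σ → GaussianConvCase ν σ R → ∀ t ∈ Set.Icc (0 : ℝ) 1, ∀ x : E d,
      JacobianLE (velocity s ν U t) x (convBound s σ R t) ∧
      LambdaMaxJacobianLE (velocity s ν U t) x (convBound s σ R t)) := by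
  refine ⟨fun κ hκ => ?_, fun σ R hσ h t ht x => ?_⟩
  swap
  · obtain ⟨β, -, hβ⟩ := hU
    have := h.jacobianLE hβ.1 hs hσ ht x
    exact ⟨this, this.lambdaMax⟩
  have hconc : IsSemiLogConcave ν U κ := hκ.elim (fun h => h.2.1) fun h => h.2.1
  have hDpos : 0 < scaledDiam ν := hκ.elim (fun h => h.2.2) fun h => h.2.2.1
  refine ⟨fun hD t ht x => hconc.1.jacobianLE_diamBound hD hs ht x,
    fun t ht hden x hx => ?_, fun hcase => ?_, fun hD D hDeq hκD => ?_⟩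
  · exact hconc.jacobianLE_kappaBound hs ⟨(Real.sqrt_nonneg _).trans ht.1, ht.2⟩
      ((kappaDenom_nonneg ht).lt_of_ne' hden) hx
  -- When `κ ≤ 0` the diameter is finite and `κ D² ≤ 0`, so neither alternative of this case can
  -- hold.
  · have hκpos : 0 < κ := by
      rcases hκ with h | h
      · exact h.1
      · rcases hcase with htop | h1
        · exact absurd htop h.2.2.2.ne
        · have := mul_nonpos_of_nonpos_of_nonneg h.1 (sq_nonneg (scaledDiam ν).toReal)
          linarith
    refine ⟨fun t ht x hx =>
      (hconc.jacobianLE_kappaBound hs ht (kappaDenom_pos hs hκpos ht) hx).lambdaMax,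
      fun hD t ht => kappaBound_le_diamBound hs ht
        (kappaDenom_pos hs hκpos ⟨ht.1, ht.2.le⟩) ?_⟩
    have h1 := hcase.resolve_left hD
    have h2 := one_sub_sq_pos ht
    have h3 : 0 ≤ s ^ 2 * (κ * (scaledDiam ν).toReal ^ 2 - 1) * (1 - t ^ 2) :=
      mul_nonneg (mul_nonneg (sq_nonneg s) (by linarith)) h2.le
    have h4 : 0 ≤ (scaledDiam ν).toReal ^ 2 * t ^ 2 := by positivity
    linarith
  · have hD0 : 0 < D := hDeq ▸ ENNReal.toReal_pos hDpos.ne' hD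
    refine ⟨fun t ht x hx => ?_, crossover_mem hs hD0 hκD, crossover_eq hs hD0 hκD,
      fun t ht hden => ?_, fun t ht => ?_⟩
    · rw [crossoverBound]
      split_ifs with hlt
      · rw [hDeq]
        exact (hconc.1.jacobianLE_diamBound hD hs
          ⟨ht.1, hlt.trans (crossover_mem hs hD0 hκD).2⟩ x).lambdaMax
      · exact (hconc.jacobianLE_kappaBound hs ht
          (kappaDenom_pos_of_crossover_le hs hD0 hκD ⟨not_lt.1 hlt, ht.2⟩) hx).lambdaMax
    · have ht1 : t < 1 := ht.2.trans (crossover_mem hs hD0 hκD).2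
      refine diamBound_le_kappaBound hs ⟨ht.1, ht1⟩ hden (le_of_lt ?_)
      exact lt_of_not_ge fun h =>
        absurd ((crossover_le_iff hs hD0 hκD ht.1).2 h) (not_le.2 ht.2)
    · have ht0 : 0 ≤ t := (Real.sqrt_nonneg _).trans ht.1
      have hden := kappaDenom_pos_of_crossover_le hs hD0 hκD ⟨ht.1, ht.2.le⟩
      exact ⟨hden, kappaBound_le_diamBound hs ⟨ht0, ht.2⟩ hden
        ((crossover_le_iff hs hD0 hκD ht0).1 ht.1)⟩
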